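/- **The Adiabatic Theorem.** Let $E$ be a complex Hilbert space and let $\mathcal H(s)$, $s\in[0,1]$, be (possibly unbounded) self-adjoint operators on a common domain $\mathcal D\subseteq E$. Assume that $\mathcal H$ is twice differentiable on $[0,1]$ with bounded derivatives: there are bounded operators $\dot{\mathcal H}(s),\ddot{\mathcal H}(s)$ such that $\frac{d}{ds}\mathcal H(s)x=\dot{\mathcal H}(s)x$ for all $x\in\mathcal D$, and $\frac{d}{ds}\dot{\mathcal H}(s)=\ddot{\mathcal H}(s)$ in the operator norm (one-sided derivatives at the endpoints; if $\mathcal D=E$ this is the ordinary case of bounded Hamiltonians). Let $b_1,b_2$ be real functions with $$\|\dot{\mathcal H}(s)\|\le b_1(s),\qquad \|\ddot{\mathcal H}(s)\|\le b_2(s)\qquad(0\le s\le1).$$ Assume that for every $s\in[0,1]$ there is a complete orthonormal system $\psi_0(s),\psi_1(s),\dots$ of eigenvectors of $\mathcal H(s)$ (finite or countably infinite), $\mathcal H(s)\psi_j(s)=\lambda_j(s)\psi_j(s)$, with $\lambda_0(s)\le\lambda_1(s)\le\cdots$. Let $0\le m\le n$ be such that the index $n+1$ occurs, let $P(s)$ be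 the orthogonal projection onto $\operatorname{span}\{\psi_m(s),\dots,\psi_n(s)\}$, $Q(s)=I-P(s)$, and put $$w(s)=\lambda_n(s)-\lambda_m(s),\qquad \gamma(s)=\begin{cases}\min\{\lambda_{n+1}(s)-\lambda_n(s),\ \lambda_m(s)-\lambda_{m-1}(s)\}, & m>0,\\ \lambda_{n+1}(s)-\lambda_n(s), & m=0,\end{cases}\qquad D(s)=1+\frac{2w(s)}{\pi\gamma(s)}.$$ Assume $\gamma(s)>0$ for all $s\in[0,1]$. Let $\tau>0$ and let $U(s)$, $s\in[0,1]$, be the unitary evolution of $\mathcal H$: the operators $U(s)$ are unitary, $U(0)=I$, and for every $x\in\mathcal D$ one has $U(s)x\in\mathcal D$ and $\frac{d}{ds}U(s)x=-i\tau\,\mathcal H(s)U(s)x$. Then for every $s\in[0,1]$ for which the integrand below is integrable on $[0,s]$, $$\|Q(s)U(s)P(0)\|\le\frac{8D^2(0)b_1(0)}{\tau\gamma^2(0)}+\frac{8D^2(s)b_1(s)}{\tau\gamma^2(s)}+\int_0^s\frac{8D^2(r)}{\tau\gamma^2(r)}\left(\frac{8(1+D(r))b_1^2(r)}{\gamma(r)}+b_2(r)\right)dr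 .$$ -/

import Mathlib

open scoped InnerProductSpace

namespace Adiabatic

noncomputable section

variable {E : Type*} [NormedAddCommGroup E] [InnerProductSpace ℂ E]

/-- `A : 𝒟 → E` is a Hamiltonian on `E` with domain `𝒟`: a self-adjoint, possibly unbounded operator
(its domain is then dense, see `IsSelfAdjoint.dense_domain`). A bounded Hamiltonian is the case
`𝒟 = ⊤`. -/
def IsHamiltonian [CompleteSpace E] {𝒟 : Submodule ℂ E} (A : 𝒟 →ₗ[ℂ] E) : Prop :=
  IsSelfAdjoint (LinearPMap.mk 𝒟 A)

/-- On `[0,1]` the family of operators `H s : 𝒟 → E` is twice differentiable, its first and second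
derivatives being the bounded operators `H₁ s` and `H₂ s`. The operators `H s` may be unbounded, so
the first derivative is taken on the vectors of the domain; the second one is the derivative of
`H₁` in the operator norm. (Since `H₁` is then norm continuous, the bounded operators extending
`H s - H 0` are differentiable in the operator norm too.) -/
structure IsTwiceDifferentiable {𝒟 : Submodule ℂ E} (H : ℝ → 𝒟 →ₗ[ℂ] E)
    (H₁ H₂ : ℝ → E →L[ℂ] E) : Prop where
  first : ∀ s ∈ Set.Icc (0 : ℝ) 1, ∀ x : 𝒟,
    HasDerivWithinAt (fun r => H r x) (H₁ s x) (Set.Icc 0 1) s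
  second : ∀ s ∈ Set.Icc (0 : ℝ) 1, HasDerivWithinAt H₁ (H₂ s) (Set.Icc 0 1) s

/-- `(φ j)`, `j ∈ J`, is a complete orthonormal system of eigenstates of `A`, with eigenvalues
`lam j` listed in nondecreasing order. (`J` will be `ℕ` or an initial segment of `ℕ`; the values of
`lam` and `φ` outside `J` play no role.) -/
structure IsEigenbasis {𝒟 : Submodule ℂ E} (A : 𝒟 →ₗ[ℂ] E) (J : Set ℕ)
    (lam : ℕ → ℝ) (φ : ℕ → E) : Prop where
  orthonormal : Orthonormal ℂ (fun j : J => φ j)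
  total : (Submodule.span ℂ (φ '' J)).topologicalClosure = ⊤
  monotone : MonotoneOn lam J
  eigen : ∀ j ∈ J, ∃ h : φ j ∈ 𝒟, A ⟨φ j, h⟩ = (lam j : ℂ) • φ j

/-- `U` is the unitary evolution on `[0,1]` solving `U' = -i τ H U`, `U 0 = 1`. As `H s` may be
unbounded, the equation is read on vectors of the domain, which the evolution preserves. -/
structure IsEvolution [CompleteSpace E] {𝒟 : Submodule ℂ E} (H : ℝ → 𝒟 →ₗ[ℂ] E) (τ : ℝ)
    (U : ℝ → E →L[ℂ] E) : Prop where
  unitary : ∀ s ∈ Set.Icc (0 : ℝ) 1, U s ∈ unitary (E →L[ℂ] E)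
  initial : U 0 = 1
  schrodinger : ∀ s ∈ Set.Icc (0 : ℝ) 1, ∀ x : 𝒟, ∃ h : U s x ∈ 𝒟,
    HasDerivWithinAt (fun r => U r x) (-(Complex.I * τ) • H s ⟨U s x, h⟩) (Set.Icc 0 1) s

/-- The span of `φ m, …, φ n`. -/
def bandSpace (φ : ℕ → E) (m n : ℕ) : Submodule ℂ E :=
  Submodule.span ℂ (φ '' Set.Icc m n)

instance bandSpace_finiteDimensional (φ : ℕ → E) (m n : ℕ) :
    FiniteDimensional ℂ (bandSpace φ m n) :=
  FiniteDimensional.span_of_finite ℂ ((Set.finite_Icc m n).image φ)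

/-- The orthogonal projection `P` onto the span of `φ m, …, φ n`. -/
def bandProj (φ : ℕ → E) (m n : ℕ) : E →L[ℂ] E :=
  (bandSpace φ m n).starProjection

/-- The spectral width `w` of the band `lam m, …, lam n`. -/
def width (lam : ℕ → ℝ) (m n : ℕ) : ℝ := lam n - lam m

/-- The gap `γ` between the band `lam m, …, lam n` and the other eigenvalues. -/
def gap (lam : ℕ → ℝ) (m n : ℕ) : ℝ :=
  if m = 0 then lam (n + 1) - lam n
  else min (lam (n + 1) - lam n) (lam m - lam (m - 1))

/-- The ratio `D = 1 + 2 w / (π γ)`. -/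
def ratio (lam : ℕ → ℝ) (m n : ℕ) : ℝ :=
  1 + 2 * width lam m n / (Real.pi * gap lam m n)

/-- The integrand of the adiabatic error bound, for given values of `τ`, `D`, `γ`, `b₁`, `b₂`. -/
def errorDensity (τ D γ b₁ b₂ : ℝ) : ℝ :=
  8 * D ^ 2 / (τ * γ ^ 2) * (8 * (1 + D) * b₁ ^ 2 / γ + b₂)

end

end Adiabatic

/-! Write `A` for the Hamiltonian and `Q = 1 - P`. If `P' = A X - X A` for a bounded differentiable
`X`, then along two solutions `u`, `v` of the Schrödinger equation the derivative `-⟨v, P' u⟩` of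
`⟨v, Q u⟩` agrees with that of `(i/τ)⟨v, X u⟩` up to `(i/τ)⟨v, X' u⟩`. Hence `⟨v, Q u⟩` changes only
by boundary terms `‖X‖/τ` and the integral of `‖X'‖/τ` (`hasDerivWithinAt_corrected`,
`IsReducing.norm_inner_transition_le`).

To find `X`, solve the Sylvester equation `A Z - Z A = Q Y P` twice: `T` for `Y = A'`, then `Z` for
`Y = T`. First-order perturbation theory gives `P' = -(T + T*)`, and `X = Z* - Z` has commutator
`P'` (`exists_commutator`). The band lies in an interval and the other eigenvalues lie outside it at
distance at least the gap `γ`, so each solution costs a factor `1/γ` (`IsSylvester.norm_le`).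
Differentiability of `P`, `T` and `Z` comes from one device: compressed difference quotients solve a
Sylvester equation at the base point, so they converge as soon as their right-hand sides do
(`compress`, `tendsto`).

The resulting bounds `‖X‖ ≤ 2‖A'‖/γ²` and `‖X'‖ ≤ 40‖A'‖²/γ³ + 2‖A''‖/γ²` are stronger than needed;
`D` enters only through `D ≥ 1`. -/

open scoped InnerProductSpace

namespace Adiabatic

open Filter Topology

/-! ### Spectral calculus of a single Hamiltonian with an eigenbasis -/

section Static

variable {E : Type*} [NormedAddCommGroup E] [InnerProductSpace ℂ E]

/-- A total linear map `A` that is self-adjoint on the domain `𝒟` and is diagonalized there by the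
complete orthonormal system `φ j`, `j ∈ J`, with eigenvalues `lam j`. -/
structure IsDiagonal (𝒟 : Submodule ℂ E) (A : E →ₗ[ℂ] E) (J : Set ℕ) (lam : ℕ → ℝ)
    (φ : ℕ → E) : Prop where
  orthonormal : Orthonormal ℂ (fun j : J => φ j)
  total : (Submodule.span ℂ (φ '' J)).topologicalClosure = ⊤
  monotone : MonotoneOn lam J
  mem : ∀ j ∈ J, φ j ∈ 𝒟
  eigen : ∀ j ∈ J, A (φ j) = (lam j : ℂ) • φ j
  symm : ∀ x ∈ 𝒟, ∀ y ∈ 𝒟, ⟪A x, y⟫_ℂ = ⟪x, A y⟫_ℂ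
  maximal : ∀ y w : E, (∀ z ∈ 𝒟, ⟪w, z⟫_ℂ = ⟪y, A z⟫_ℂ) → y ∈ 𝒟

/-- `Z` maps the range of the projection `P` into its kernel, and solves there the Sylvester
equation `A Z - Z A = (1 - P) Y P`. -/
structure IsSylvester (𝒟 : Submodule ℂ E) (A : E →ₗ[ℂ] E) (P Y Z : E →L[ℂ] E) : Prop where
  left : P * Z = 0
  right : Z * P = Z
  mem : ∀ x, Z x ∈ 𝒟
  eq : ∀ x ∈ 𝒟, A (Z x) - Z (A x) = ((1 - P) * Y * P) x

/-- The orthogonal projection `P` reduces the symmetric operator `A`; the spectrum of `A` is within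
`ρ` of `c` on the range of `P` and at distance at least `ρ + δ` from `c` on its kernel. -/
structure IsReducing [CompleteSpace E] (𝒟 : Submodule ℂ E) (A : E →ₗ[ℂ] E) (P : E →L[ℂ] E)
    (c ρ δ : ℝ) : Prop where
  symm : ∀ x ∈ 𝒟, ∀ y ∈ 𝒟, ⟪A x, y⟫_ℂ = ⟪x, A y⟫_ℂ
  nonneg : 0 ≤ ρ
  mem : ∀ x, P x ∈ 𝒟
  idem : P * P = P
  star_eq : star P = P
  comm : ∀ x ∈ 𝒟, P (A x) = A (P x)
  upper : ∀ x, ‖A (P x) - (c : ℂ) • P x‖ ≤ ρ * ‖P x‖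
  lower : ∀ y ∈ 𝒟, P y = 0 → (ρ + δ) * ‖y‖ ≤ ‖A y - (c : ℂ) • y‖
  solvable : ∀ Y, ∃ Z, IsSylvester 𝒟 A P Y Z

namespace IsDiagonal

variable {𝒟 : Submodule ℂ E} {A : E →ₗ[ℂ] E} {J : Set ℕ} {lam : ℕ → ℝ} {φ : ℕ → E}

theorem inner_eigen (h : IsDiagonal 𝒟 A J lam φ) {k : ℕ} (hk : k ∈ J) {x : E} (hx : x ∈ 𝒟) :
    ⟪φ k, A x⟫_ℂ = lam k * ⟪φ k, x⟫_ℂ := by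
  rw [← h.symm _ (h.mem k hk) _ hx, h.eigen k hk, inner_smul_left, Complex.conj_ofReal]

theorem inner_eq_zero (h : IsDiagonal 𝒟 A J lam φ) {j k : ℕ} (hj : j ∈ J) (hk : k ∈ J)
    (hjk : j ≠ k) : ⟪φ j, φ k⟫_ℂ = 0 :=
  h.orthonormal.2 (i := ⟨j, hj⟩) (j := ⟨k, hk⟩) (by simpa using hjk)

theorem inner_self (h : IsDiagonal 𝒟 A J lam φ) {j : ℕ} (hj : j ∈ J) : ⟪φ j, φ j⟫_ℂ = 1 := by
  rw [inner_self_eq_norm_sq_to_K, h.orthonormal.1 ⟨j, hj⟩]; simp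

variable {m n : ℕ}

theorem inner_bandProj (h : IsDiagonal 𝒟 A J lam φ) (hJ : Set.Icc m n ⊆ J) {k : ℕ} (hk : k ∈ J)
    (x : E) : ⟪φ k, bandProj φ m n x⟫_ℂ = if k ∈ Set.Icc m n then ⟪φ k, x⟫_ℂ else 0 := by
  rw [bandProj, ← Submodule.inner_starProjection_left_eq_right]
  split_ifs with hkI
  · rw [Submodule.starProjection_eq_self_iff.2]
    exact Submodule.subset_span ⟨k, hkI, rfl⟩
  · rw [(Submodule.starProjection_apply_eq_zero_iff _).2, inner_zero_left]
    have hle : bandSpace φ m n ≤ (Submodule.span ℂ {φ k})ᗮ := by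
      refine Submodule.span_le.2 ?_
      rintro _ ⟨i, hi, rfl⟩
      refine Submodule.mem_orthogonal_singleton_iff_inner_right.2 ?_
      exact h.inner_eq_zero hk (hJ hi) (by rintro rfl; exact hkI hi)
    rw [Submodule.mem_orthogonal]
    intro u hu
    exact Submodule.mem_orthogonal_singleton_iff_inner_left.1 (hle hu)

/-- The reference point `μ` is left free because it is used both for an eigenvalue of the band and
for the centre of the band. -/
theorem gap_le_sub_or (h : IsDiagonal 𝒟 A J lam φ) (hJ : IsLowerSet J) (hn : n + 1 ∈ J)
    (hmn : m ≤ n) (μ : ℝ) {k : ℕ} (hk : k ∈ J)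
    (hkI : k ∉ Set.Icc m n) :
    gap lam m n + (lam n - μ) ≤ lam k - μ ∨ gap lam m n + (μ - lam m) ≤ μ - lam k := by
  simp only [Set.mem_Icc, not_and, not_le] at hkI
  rcases lt_or_ge k m with hkm | hkm
  · right
    have h1 := h.monotone hk (hJ (by omega : m - 1 ≤ n + 1) hn) (by omega : k ≤ m - 1)
    have h2 : gap lam m n ≤ lam m - lam (m - 1) := by
      rw [gap, if_neg (by omega)]; exact min_le_right _ _
    linarith
  · left
    have h1 := h.monotone hn hk (hkI hkm)
    have h2 : gap lam m n ≤ lam (n + 1) - lam n := by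
      rw [gap]; split_ifs
      · exact le_rfl
      · exact min_le_left _ _
    linarith

theorem mem_Icc_of_band (h : IsDiagonal 𝒟 A J lam φ) (hJ : IsLowerSet J) (hn : n + 1 ∈ J) {j : ℕ}
    (hj : j ∈ Set.Icc m n) : lam j ∈ Set.Icc (lam m) (lam n) := by
  have hI : ∀ i ≤ n, i ∈ J := fun i hi => hJ (by omega : i ≤ n + 1) hn
  exact ⟨h.monotone (hI m (hj.1.trans hj.2)) (hI j hj.2) hj.1,
    h.monotone (hI j hj.2) (hI n le_rfl) hj.2⟩

variable [CompleteSpace E]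

theorem exists_hilbertBasis (h : IsDiagonal 𝒟 A J lam φ) :
    ∃ b : HilbertBasis J ℂ E, ∀ j : J, b j = φ j := by
  refine ⟨HilbertBasis.mk h.orthonormal ?_, fun j => ?_⟩
  · rw [← Set.image_eq_range, h.total]
  · rw [HilbertBasis.coe_mk]

theorem hasSum_inner (h : IsDiagonal 𝒟 A J lam φ) (x y : E) :
    HasSum (fun k : J => ⟪x, φ k⟫_ℂ * ⟪φ k, y⟫_ℂ) ⟪x, y⟫_ℂ := by
  obtain ⟨b, hb⟩ := h.exists_hilbertBasis
  simpa only [hb] using b.hasSum_inner_mul_inner x y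

theorem hasSum_norm_sq (h : IsDiagonal 𝒟 A J lam φ) (x : E) :
    HasSum (fun k : J => ‖⟪φ k, x⟫_ℂ‖ ^ 2) (‖x‖ ^ 2) := by
  have := Complex.hasSum_re (h.hasSum_inner x x)
  rw [inner_self_eq_norm_sq_to_K] at this
  convert this using 1
  · ext k
    rw [← inner_conj_symm x, mul_comm, Complex.mul_conj, Complex.normSq_eq_norm_sq, Complex.ofReal_re]
  · norm_cast

theorem ext (h : IsDiagonal 𝒟 A J lam φ) {x y : E}
    (hxy : ∀ k ∈ J, ⟪φ k, x⟫_ℂ = ⟪φ k, y⟫_ℂ) : x = y := by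
  have h1 := h.hasSum_norm_sq (x - y)
  have h2 : (fun k : J => ‖⟪φ k, x - y⟫_ℂ‖ ^ 2) = fun _ => 0 := by
    ext k; rw [inner_sub_right, hxy k k.2]; simp
  rw [h2] at h1
  have := h1.unique hasSum_zero
  simpa [sub_eq_zero] using this

theorem hasSum_norm_sq_sub (h : IsDiagonal 𝒟 A J lam φ) {x : E} (hx : x ∈ 𝒟) (c : ℝ) :
    HasSum (fun k : J => (lam k - c) ^ 2 * ‖⟪φ k, x⟫_ℂ‖ ^ 2) (‖A x - (c : ℂ) • x‖ ^ 2) := by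
  convert h.hasSum_norm_sq (A x - (c : ℂ) • x) using 2 with k
  rw [inner_sub_right, h.inner_eigen k.2 hx, inner_smul_right, ← sub_mul, ← Complex.ofReal_sub,
    norm_mul, mul_pow, Complex.norm_real, Real.norm_eq_abs, sq_abs]

theorem hasSum_re_inner (h : IsDiagonal 𝒟 A J lam φ) {x : E} (hx : x ∈ 𝒟) :
    HasSum (fun k : J => lam k * ‖⟪φ k, x⟫_ℂ‖ ^ 2) (⟪x, A x⟫_ℂ).re := by
  convert Complex.hasSum_re (h.hasSum_inner x (A x)) using 2 with k
  rw [h.inner_eigen k.2 hx, ← inner_conj_symm x, mul_left_comm, mul_comm (starRingEnd ℂ _),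
    Complex.mul_conj, Complex.normSq_eq_norm_sq, ← Complex.ofReal_mul, Complex.ofReal_re]

/-- One half of Weyl's perturbation inequality for ordered eigenvalues. -/
theorem eigenvalue_le {A' : E →ₗ[ℂ] E} {lam' : ℕ → ℝ} {φ' : ℕ → E} {Δ : E →L[ℂ] E}
    (h : IsDiagonal 𝒟 A J lam φ) (h' : IsDiagonal 𝒟 A' J lam' φ')
    (hΔ : ∀ x ∈ 𝒟, A' x = A x + Δ x) (hJ : IsLowerSet J) {j : ℕ} (hj : j ∈ J) :
    lam' j ≤ lam j + ‖Δ‖ := by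
  have hJi : ∀ i ≤ j, i ∈ J := fun i hi => hJ hi hj
  let S : (Fin (j + 1) → ℂ) →ₗ[ℂ] E := Fintype.linearCombination ℂ (fun i : Fin (j + 1) => φ i)
  let T : (Fin (j + 1) → ℂ) →ₗ[ℂ] (Fin j → ℂ) :=
    LinearMap.pi fun k : Fin j => (innerₛₗ ℂ (φ' k)).comp S
  -- Courant–Fischer by counting dimensions: among the combinations of `φ 0, …, φ j` some nonzero
  -- one is orthogonal to the `j` vectors `φ' 0, …, φ' (j - 1)`. Its Rayleigh quotient is at most
  -- `lam j` for `A` and at least `lam' j` for `A'`.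
  have hT : LinearMap.ker T ≠ ⊥ := LinearMap.ker_ne_bot_of_finrank_lt (by simp)
  obtain ⟨a, ha, ha0⟩ := (Submodule.ne_bot_iff _).1 hT
  have hS : S a = ∑ i : Fin (j + 1), a i • φ i := rfl
  have hxD : S a ∈ 𝒟 := by
    rw [hS]; exact sum_mem fun i _ => 𝒟.smul_mem _ (h.mem i (hJi i (by omega)))
  have hcoef : ∀ i : Fin (j + 1), ⟪φ i, S a⟫_ℂ = a i := by
    intro i
    rw [hS, inner_sum, Finset.sum_eq_single i]
    · rw [inner_smul_right, h.inner_self (hJi i (by omega)), mul_one]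
    · intro k _ hk
      rw [inner_smul_right, h.inner_eq_zero (hJi i (by omega)) (hJi k (by omega)), mul_zero]
      exact fun e => hk (Fin.ext e.symm)
    · simp
  have hzero : ∀ k ∈ J, j < k → ⟪φ k, S a⟫_ℂ = 0 := by
    intro k hk hjk
    rw [hS, inner_sum]
    refine Finset.sum_eq_zero fun i _ => ?_
    rw [inner_smul_right, h.inner_eq_zero hk (hJi i (by omega)) (by omega), mul_zero]
  have hzero' : ∀ k < j, ⟪φ' k, S a⟫_ℂ = 0 := fun k hk => congrFun ha ⟨k, hk⟩
  have hx0 : S a ≠ 0 := by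
    intro e
    apply ha0
    ext i
    rw [← hcoef i, e]; simp
  have hpos : 0 < ‖S a‖ ^ 2 := by positivity
  have up : (⟪S a, A (S a)⟫_ℂ).re ≤ lam j * ‖S a‖ ^ 2 := by
    refine hasSum_le (fun k => ?_) (h.hasSum_re_inner hxD) ((h.hasSum_norm_sq (S a)).mul_left _)
    rcases lt_or_ge j k.1 with hk | hk
    · rw [hzero k k.2 hk]; simp
    · exact mul_le_mul_of_nonneg_right (h.monotone k.2 hj hk) (by positivity)
  have low : lam' j * ‖S a‖ ^ 2 ≤ (⟪S a, A' (S a)⟫_ℂ).re := by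
    refine hasSum_le (fun k => ?_) ((h'.hasSum_norm_sq (S a)).mul_left _) (h'.hasSum_re_inner hxD)
    rcases lt_or_ge k.1 j with hk | hk
    · rw [hzero' k hk]; simp
    · exact mul_le_mul_of_nonneg_right (h'.monotone hj k.2 hk) (by positivity)
  have hd : (⟪S a, Δ (S a)⟫_ℂ).re ≤ ‖Δ‖ * ‖S a‖ ^ 2 := by
    refine (Complex.re_le_norm _).trans ((norm_inner_le_norm _ _).trans ?_)
    have := mul_le_mul_of_nonneg_left (Δ.le_opNorm (S a)) (norm_nonneg (S a))
    linarith [this, sq (‖S a‖)]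
  rw [hΔ _ hxD, inner_add_right, Complex.add_re] at low
  refine le_of_mul_le_mul_right ?_ hpos
  linarith

theorem abs_eigenvalue_sub_le {A' : E →ₗ[ℂ] E} {lam' : ℕ → ℝ} {φ' : ℕ → E} {Δ : E →L[ℂ] E}
    (h : IsDiagonal 𝒟 A J lam φ) (h' : IsDiagonal 𝒟 A' J lam' φ')
    (hΔ : ∀ x ∈ 𝒟, A' x = A x + Δ x) (hJ : IsLowerSet J) {j : ℕ} (hj : j ∈ J) :
    |lam' j - lam j| ≤ ‖Δ‖ := by
  have h1 := h.eigenvalue_le h' hΔ hJ hj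
  have h2 := h'.eigenvalue_le h (Δ := -Δ) (fun x hx => by rw [hΔ x hx]; simp) hJ hj
  rw [norm_neg] at h2
  exact abs_le.2 ⟨by linarith, by linarith⟩

/-- If all coefficients of `x` at indices with eigenvalue `μ` vanish, and the other eigenvalues
stay away from `μ`, then `A - μ` can be inverted on `x`. -/
theorem exists_resolvent (h : IsDiagonal 𝒟 A J lam φ) {μ δ : ℝ} (hδ : 0 < δ) {x : E}
    (hx : ∀ k ∈ J, ⟪φ k, x⟫_ℂ = 0 ∨ δ ≤ |lam k - μ|) :
    ∃ y ∈ 𝒟, A y - (μ : ℂ) • y = x ∧ ∀ k ∈ J, ⟪φ k, x⟫_ℂ = 0 → ⟪φ k, y⟫_ℂ = 0 := by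
  obtain ⟨b, hb⟩ := h.exists_hilbertBasis
  -- Where `lam k = μ` the coefficient of `x` vanishes, and `0 / 0 = 0` is the value wanted.
  have hmem : Memℓp (fun k : J => ⟪φ k, x⟫_ℂ / ((lam k - μ : ℝ) : ℂ)) 2 := by
    refine memℓp_gen ?_
    have hs : Summable fun k : J => (1 / δ) ^ 2 * ‖⟪φ k, x⟫_ℂ‖ ^ 2 :=
      (h.hasSum_norm_sq x).summable.mul_left _
    refine Summable.of_nonneg_of_le (fun k => by positivity) (fun k => ?_) hs
    simp only [ENNReal.toReal_ofNat, Real.rpow_ofNat, norm_div, Complex.norm_real,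
      Real.norm_eq_abs]
    rw [← mul_pow]
    rcases hx k k.2 with h0 | h0
    · rw [h0]; simp
    · gcongr
      rw [one_div, mul_comm, ← div_eq_mul_inv]
      gcongr
  let y : E := b.repr.symm ⟨_, hmem⟩
  have hy : ∀ k (hk : k ∈ J), ⟪φ k, y⟫_ℂ = ⟪φ k, x⟫_ℂ / ((lam k - μ : ℝ) : ℂ) := by
    intro k hk
    have := b.repr_apply_apply y ⟨k, hk⟩
    rw [hb] at this
    rw [← this]
    simp [y]
  have hyx : ∀ k ∈ J, ((lam k - μ : ℝ) : ℂ) * ⟪φ k, y⟫_ℂ = ⟪φ k, x⟫_ℂ := by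
    intro k hk
    rw [hy k hk]
    rcases hx k hk with h0 | h0
    · simp [h0]
    · have : ((lam k - μ : ℝ) : ℂ) ≠ 0 := by
        rw [Complex.ofReal_ne_zero]
        intro e
        rw [e, abs_zero] at h0
        linarith
      field_simp
  -- The series alone does not place `y` in the domain; self-adjointness does, since `z ↦ ⟪y, A z⟫`
  -- is represented by `x + μ y`.
  have hyD : y ∈ 𝒟 := by
    refine h.maximal y (x + (μ : ℂ) • y) fun z hz => ?_
    refine (h.hasSum_inner _ z).unique ?_
    convert h.hasSum_inner y (A z) using 2 with k
    rw [h.inner_eigen k.2 hz, inner_add_left, inner_smul_left, Complex.conj_ofReal,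
      ← inner_conj_symm x, ← hyx k k.2, map_mul, inner_conj_symm, Complex.conj_ofReal,
      Complex.ofReal_sub]
    ring
  refine ⟨y, hyD, h.ext fun k hk => ?_, fun k hk h0 => by rw [hy k hk, h0, zero_div]⟩
  rw [inner_sub_right, h.inner_eigen hk hyD, inner_smul_right, ← hyx k hk, Complex.ofReal_sub,
    sub_mul]

theorem bandProj_apply (h : IsDiagonal 𝒟 A J lam φ) (hJ : Set.Icc m n ⊆ J) (x : E) :
    bandProj φ m n x = ∑ j ∈ Finset.Icc m n, ⟪φ j, x⟫_ℂ • φ j := by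
  refine h.ext fun k hk => ?_
  rw [h.inner_bandProj hJ hk, inner_sum]
  split_ifs with hkI
  · rw [Finset.sum_eq_single k]
    · rw [inner_smul_right, h.inner_self hk, mul_one]
    · intro j hj hjk
      rw [inner_smul_right, h.inner_eq_zero hk (hJ (by simpa using hj)) hjk.symm, mul_zero]
    · intro hk'; exact absurd (by simpa using hkI) hk'
  · symm
    refine Finset.sum_eq_zero fun j hj => ?_
    have hj' : j ∈ Set.Icc m n := by simpa using hj
    rw [inner_smul_right, h.inner_eq_zero hk (hJ hj') (by rintro rfl; exact hkI hj'), mul_zero]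

theorem bandProj_mem (h : IsDiagonal 𝒟 A J lam φ) (hJ : Set.Icc m n ⊆ J) (x : E) :
    bandProj φ m n x ∈ 𝒟 := by
  rw [h.bandProj_apply hJ]
  exact sum_mem fun j hj => 𝒟.smul_mem _ (h.mem j (hJ (by simpa using hj)))

/-- As the band is finite, the equation decouples over its eigenvectors: `Z` sends `φ j` to `y j =
(A - lam j)⁻¹ (1 - P) Y φ j`, the inverse being taken off the band, where the gap makes it bounded.
-/
theorem exists_isSylvester (h : IsDiagonal 𝒟 A J lam φ) (hJ : IsLowerSet J) (hn : n + 1 ∈ J)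
    (hmn : m ≤ n) (hgap : 0 < gap lam m n) (Y : E →L[ℂ] E) :
    ∃ Z, IsSylvester 𝒟 A (bandProj φ m n) Y Z := by
  have hI : Set.Icc m n ⊆ J := fun i hi => hJ (by have := hi.2; omega : i ≤ n + 1) hn
  have hres : ∀ j, ∃ y ∈ 𝒟, j ∈ Set.Icc m n →
      (A y - (lam j : ℂ) • y = (1 - bandProj φ m n) (Y (φ j)) ∧ bandProj φ m n y = 0) := by
    intro j
    by_cases hj : j ∈ Set.Icc m n
    · have hx : ∀ k ∈ J, k ∈ Set.Icc m n → ⟪φ k, (1 - bandProj φ m n) (Y (φ j))⟫_ℂ = 0 := by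
        intro k hk hkI
        rw [sub_apply, inner_sub_right, h.inner_bandProj hI hk, if_pos hkI]
        simp
      obtain ⟨y, hyD, hy, hy0⟩ := h.exists_resolvent (μ := lam j) hgap
        (x := (1 - bandProj φ m n) (Y (φ j))) fun k hk => by
          by_cases hkI : k ∈ Set.Icc m n
          · exact Or.inl (hx k hk hkI)
          · right
            have hμ := h.mem_Icc_of_band hJ hn hj
            rcases h.gap_le_sub_or hJ hn hmn _ hk hkI with h1 | h1
            · exact (by linarith [hμ.2] : gap lam m n ≤ lam k - lam j).trans (le_abs_self _)
            · rw [abs_sub_comm]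
              exact (by linarith [hμ.1] : gap lam m n ≤ lam j - lam k).trans (le_abs_self _)
      refine ⟨y, hyD, fun _ => ⟨hy, h.ext fun k hk => ?_⟩⟩
      rw [h.inner_bandProj hI hk, inner_zero_right]
      split_ifs with hkI
      · exact hy0 k hk (hx k hk hkI)
      · rfl
    · exact ⟨0, 𝒟.zero_mem, fun hj' => absurd hj' hj⟩
  choose y hyD hy using hres
  refine ⟨∑ j ∈ Finset.Icc m n, (innerSL ℂ (φ j)).smulRight (y j), ?_, ?_, ?_, ?_⟩
  · ext x
    simp only [mul_apply_eq_comp, sum_apply,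
      ContinuousLinearMap.smulRight_apply, innerSL_apply_apply, map_sum, map_smul,
      zero_apply]
    refine Finset.sum_eq_zero fun j hj => ?_
    rw [(hy j (by simpa using hj)).2, smul_zero]
  · ext x
    simp only [mul_apply_eq_comp, sum_apply,
      ContinuousLinearMap.smulRight_apply, innerSL_apply_apply]
    refine Finset.sum_congr rfl fun j hj => ?_
    have hj' : j ∈ Set.Icc m n := by simpa using hj
    rw [h.inner_bandProj hI (hI hj'), if_pos hj']
  · intro x
    simp only [sum_apply, ContinuousLinearMap.smulRight_apply]
    exact sum_mem fun j _ => 𝒟.smul_mem _ (hyD j)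
  · intro x hx
    rw [mul_apply_eq_comp, mul_apply_eq_comp, h.bandProj_apply hI]
    simp only [sum_apply, ContinuousLinearMap.smulRight_apply,
      innerSL_apply_apply, map_sum, map_smul]
    rw [← Finset.sum_sub_distrib]
    refine Finset.sum_congr rfl fun j hj => ?_
    have hj' : j ∈ Set.Icc m n := by simpa using hj
    rw [h.inner_eigen (hI hj') hx, ← (hy j hj').1, smul_sub, smul_smul, mul_comm]

/-- The spectral projection onto a band separated by a gap reduces the Hamiltonian. -/
theorem isReducing (h : IsDiagonal 𝒟 A J lam φ) (hJ : IsLowerSet J) (hn : n + 1 ∈ J)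
    (hmn : m ≤ n) (hgap : 0 < gap lam m n) :
    IsReducing 𝒟 A (bandProj φ m n) ((lam m + lam n) / 2) (width lam m n / 2) (gap lam m n) := by
  have hI : Set.Icc m n ⊆ J := fun i hi => hJ (by have := hi.2; omega : i ≤ n + 1) hn
  have hle : lam m ≤ lam n := (h.mem_Icc_of_band hJ hn (⟨hmn, le_rfl⟩ : n ∈ Set.Icc m n)).1
  have hρ : 0 ≤ width lam m n / 2 := by rw [width]; linarith
  refine ⟨h.symm, hρ, h.bandProj_mem hI, ?_, ?_, ?_, ?_, ?_, h.exists_isSylvester hJ hn hmn hgap⟩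
  · exact (bandSpace φ m n).isIdempotentElem_starProjection
  · exact isSelfAdjoint_starProjection _
  · intro x hx
    refine h.ext fun k hk => ?_
    rw [h.inner_bandProj hI hk, h.inner_eigen hk hx, h.inner_eigen hk (h.bandProj_mem hI x),
      h.inner_bandProj hI hk]
    split_ifs <;> simp
  · intro x
    refine le_of_sq_le_sq ?_ (by positivity)
    rw [mul_pow]
    refine hasSum_le (fun k => ?_) (h.hasSum_norm_sq_sub (h.bandProj_mem hI x) _)
      ((h.hasSum_norm_sq (bandProj φ m n x)).mul_left _)
    rw [h.inner_bandProj hI k.2]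
    split_ifs with hkI
    · have hμ := h.mem_Icc_of_band hJ hn hkI
      refine mul_le_mul_of_nonneg_right ?_ (by positivity)
      rw [width] at *
      refine sq_le_sq' ?_ ?_ <;> linarith [hμ.1, hμ.2]
    · simp
  · intro y hy hy0
    refine le_of_sq_le_sq ?_ (norm_nonneg _)
    rw [mul_pow]
    refine hasSum_le (fun k => ?_) ((h.hasSum_norm_sq y).mul_left _) (h.hasSum_norm_sq_sub hy _)
    by_cases hkI : k.1 ∈ Set.Icc m n
    · have := h.inner_bandProj hI k.2 y
      rw [hy0, inner_zero_right, if_pos hkI] at this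
      rw [← this]; simp
    · refine mul_le_mul_of_nonneg_right ?_ (by positivity)
      rw [← sq_abs (_ - _)]
      refine pow_le_pow_left₀ (by positivity) ?_ 2
      rw [width]
      rcases h.gap_le_sub_or hJ hn hmn _ k.2 hkI with h1 | h1
      · exact le_trans (by linarith) (le_abs_self _)
      · rw [abs_sub_comm]
        exact le_trans (by linarith) (le_abs_self _)

end IsDiagonal

end Static

/-! ### Sylvester's equation and the Davis–Kahan bound -/

section Sylvester

variable {E : Type*} [NormedAddCommGroup E] [InnerProductSpace ℂ E]
  {𝒟 : Submodule ℂ E} {A A' : E →ₗ[ℂ] E} {P P' Y Y' Z Z' Δ : E →L[ℂ] E} {c ρ δ c' ρ' δ' : ℝ}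

namespace IsSylvester

theorem apply_proj (hZ : IsSylvester 𝒟 A P Y Z) (x : E) : Z (P x) = Z x :=
  DFunLike.congr_fun hZ.right x

theorem congr (hZ : IsSylvester 𝒟 A P Y Z) (hY : (1 - P) * Y * P = (1 - P) * Y' * P) :
    IsSylvester 𝒟 A P Y' Z :=
  ⟨hZ.left, hZ.right, hZ.mem, fun x hx => by rw [hZ.eq x hx, hY]⟩

theorem sub (hZ : IsSylvester 𝒟 A P Y Z) (hZ' : IsSylvester 𝒟 A P Y' Z') :
    IsSylvester 𝒟 A P (Y - Y') (Z - Z') := by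
  refine ⟨?_, ?_, fun x => 𝒟.sub_mem (hZ.mem x) (hZ'.mem x), fun x hx => ?_⟩
  · rw [mul_sub, hZ.left, hZ'.left, sub_zero]
  · rw [sub_mul, hZ.right, hZ'.right]
  · rw [mul_sub, sub_mul, sub_apply, sub_apply, sub_apply, ← hZ.eq x hx, ← hZ'.eq x hx, map_sub]
    abel

theorem smul (hZ : IsSylvester 𝒟 A P Y Z) (t : ℝ) : IsSylvester 𝒟 A P (t • Y) (t • Z) := by
  refine ⟨?_, ?_, fun x => 𝒟.smul_of_tower_mem t (hZ.mem x), fun x hx => ?_⟩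
  · rw [mul_smul_comm, hZ.left, smul_zero]
  · rw [smul_mul_assoc, hZ.right]
  · rw [mul_smul_comm, smul_mul_assoc, smul_apply, smul_apply, smul_apply, ← hZ.eq x hx,
      LinearMap.map_smul_of_tower, smul_sub]

end IsSylvester

variable [CompleteSpace E]

namespace IsReducing

theorem norm_le_one (h : IsReducing 𝒟 A P c ρ δ) : ‖P‖ ≤ 1 :=
  IsStarProjection.norm_le P ⟨h.idem, h.star_eq⟩

theorem norm_one_sub_le_one (h : IsReducing 𝒟 A P c ρ δ) : ‖1 - P‖ ≤ 1 :=
  IsStarProjection.norm_le (1 - P) (IsStarProjection.one_sub ⟨h.idem, h.star_eq⟩)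

theorem proj_proj (h : IsReducing 𝒟 A P c ρ δ) (x : E) : P (P x) = P x :=
  DFunLike.congr_fun h.idem x

theorem proj_one_sub (h : IsReducing 𝒟 A P c ρ δ) (x : E) : P ((1 - P) x) = 0 := by
  simp [h.proj_proj]

theorem one_sub_mem (h : IsReducing 𝒟 A P c ρ δ) {x : E} (hx : x ∈ 𝒟) : (1 - P) x ∈ 𝒟 :=
  𝒟.sub_mem hx (h.mem x)

theorem map_one_sub (h : IsReducing 𝒟 A P c ρ δ) {x : E} (hx : x ∈ 𝒟) :
    A ((1 - P) x) = (1 - P) (A x) := by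
  simp [h.comm x hx]

/-- A Davis-Kahan estimate for the spectral projections of two Hamiltonians. -/
theorem norm_one_sub_mul_le (h : IsReducing 𝒟 A P c ρ δ) (h' : IsReducing 𝒟 A' P' c' ρ' δ')
    (hA : ∀ x ∈ 𝒟, A' x = A x + Δ x) :
    (ρ' + δ' - |c' - c| - ρ) * ‖(1 - P') * P‖ ≤ ‖Δ‖ := by
  have key : ∀ x, ‖((1 - P') * P) x‖ * (ρ' + δ' - |c' - c|) ≤
      (ρ * ‖(1 - P') * P‖ + ‖Δ‖) * ‖x‖ := by
    intro x
    have hx : ‖P x‖ ≤ ‖x‖ := (P.le_of_opNorm_le h.norm_le_one x).trans_eq (one_mul _)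
    set y := ((1 - P') * P) x with hy
    have hyD : y ∈ 𝒟 := h'.one_sub_mem (h.mem x)
    have hl := h'.lower y hyD (h'.proj_one_sub _)
    -- The left side has norm at least `(ρ' + δ')‖y‖`. On the right `A - c` is at most `ρ` on the
    -- range of `P`, so the unknown norm `‖(1 - P') P‖` reappears with factor `ρ` and can be
    -- absorbed.
    have e : A' y - (c' : ℂ) • y = ((1 - P') * P) (A (P x) - (c : ℂ) • P x)
        + (1 - P') (Δ (P x)) + ((c - c' : ℝ) : ℂ) • y := by
      have e1 : A' y = (1 - P') (A (P x) + Δ (P x)) := by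
        rw [← hA _ (h.mem x), ← h'.map_one_sub (h.mem x)]; rfl
      have e2 : P (A (P x)) = A (P x) := by rw [h.comm _ (h.mem x), h.proj_proj]
      rw [e1, hy]
      simp only [mul_apply_eq_comp, map_add, map_sub, map_smul, e2, h.proj_proj,
        Complex.ofReal_sub, sub_smul]
      abel
    have b1 : ‖((1 - P') * P) (A (P x) - (c : ℂ) • P x)‖ ≤ ‖(1 - P') * P‖ * (ρ * ‖x‖) :=
      (ContinuousLinearMap.le_opNorm _ _).trans (mul_le_mul_of_nonneg_left
        ((h.upper x).trans (mul_le_mul_of_nonneg_left hx h.nonneg)) (norm_nonneg _))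
    have b2 : ‖(1 - P') (Δ (P x))‖ ≤ ‖Δ‖ * ‖x‖ :=
      ((ContinuousLinearMap.le_of_opNorm_le _ h'.norm_one_sub_le_one _).trans_eq
        (one_mul _)).trans (Δ.le_opNorm_of_le hx)
    have b3 : ‖((c - c' : ℝ) : ℂ) • y‖ = |c' - c| * ‖y‖ := by
      rw [norm_smul, Complex.norm_real, Real.norm_eq_abs, abs_sub_comm]
    rw [e] at hl
    have := hl.trans (norm_add₃_le)
    rw [b3] at this
    linarith
  rcases le_or_gt (ρ' + δ' - |c' - c|) 0 with h0 | h0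
  · have := mul_nonpos_of_nonpos_of_nonneg (by linarith [h.nonneg] : ρ' + δ' - |c' - c| - ρ ≤ 0)
      (norm_nonneg ((1 - P') * P))
    exact this.trans (norm_nonneg _)
  · have := ContinuousLinearMap.opNorm_le_bound ((1 - P') * P)
      (M := (ρ * ‖(1 - P') * P‖ + ‖Δ‖) / (ρ' + δ' - |c' - c|))
      (div_nonneg (add_nonneg (mul_nonneg h.nonneg (norm_nonneg _)) (norm_nonneg _)) h0.le)
      fun x => by
        rw [div_mul_eq_mul_div, le_div_iff₀ h0]
        exact key x
    rw [le_div_iff₀ h0] at this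
    linarith

end IsReducing

namespace IsSylvester

/-- From `(A - c) Z = (1 - P) Y P + Z (A - c) P` one gets `(ρ + δ)‖Z‖ ≤ ‖Y‖ + ρ‖Z‖`, and the `ρ`
terms cancel. The width of the band therefore does not enter the constant. -/
theorem norm_le (hZ : IsSylvester 𝒟 A P Y Z) (h : IsReducing 𝒟 A P c ρ δ) (hδ : 0 < δ) :
    ‖Z‖ ≤ ‖Y‖ / δ := by
  have hρδ : 0 < ρ + δ := by linarith [h.nonneg]
  have := Z.opNorm_le_bound (M := (‖Y‖ + ‖Z‖ * ρ) / (ρ + δ))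
    (div_nonneg (add_nonneg (norm_nonneg _) (mul_nonneg (norm_nonneg _) h.nonneg)) hρδ.le)
    fun x => by
      have hx : ‖P x‖ ≤ ‖x‖ := (P.le_of_opNorm_le h.norm_le_one x).trans_eq (one_mul _)
      rw [div_mul_eq_mul_div, le_div_iff₀ hρδ, mul_comm]
      have hl := h.lower (Z x) (hZ.mem x) (DFunLike.congr_fun hZ.left x)
      have e : A (Z x) - (c : ℂ) • Z x
          = (1 - P) (Y (P x)) + Z (A (P x) - (c : ℂ) • P x) := by
        have := hZ.eq (P x) (h.mem x)
        rw [hZ.apply_proj] at this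
        rw [map_sub, map_smul, hZ.apply_proj, sub_eq_iff_eq_add.1 this]
        simp only [mul_apply_eq_comp, h.proj_proj]
        abel
      have b1 : ‖(1 - P) (Y (P x))‖ ≤ ‖Y‖ * ‖x‖ :=
        ((ContinuousLinearMap.le_of_opNorm_le _ h.norm_one_sub_le_one _).trans_eq
          (one_mul _)).trans (Y.le_opNorm_of_le hx)
      have b2 : ‖Z (A (P x) - (c : ℂ) • P x)‖ ≤ ‖Z‖ * (ρ * ‖x‖) :=
        Z.le_opNorm_of_le ((h.upper x).trans (mul_le_mul_of_nonneg_left hx h.nonneg))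
      rw [e] at hl
      have := hl.trans (norm_add_le _ _)
      linarith
  rw [le_div_iff₀ hρδ] at this
  rw [le_div_iff₀ hδ]
  linarith

/-- By linearity `norm_le` applies to `Z' - Z`, so solutions depend continuously on the right-hand
side. -/
theorem tendsto {ι : Type*} {l : Filter ι} {Y' Z' : ι → E →L[ℂ] E}
    (hZ : IsSylvester 𝒟 A P Y Z) (h : IsReducing 𝒟 A P c ρ δ) (hδ : 0 < δ)
    (hZ' : ∀ᶠ i in l, IsSylvester 𝒟 A P (Y' i) (Z' i)) (hY' : Tendsto Y' l (𝓝 Y)) :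
    Tendsto Z' l (𝓝 Z) := by
  rw [tendsto_iff_norm_sub_tendsto_zero] at hY' ⊢
  refine squeeze_zero' (Eventually.of_forall fun _ => norm_nonneg _) ?_
    (by simpa using hY'.div_const δ)
  filter_upwards [hZ'] with i hi
  exact (hi.sub hZ).norm_le h hδ

/-- Compressing an operator with a known commutator with `A' = A + Δ`. -/
theorem compress {M N : E →L[ℂ] E} (h : IsReducing 𝒟 A P c ρ δ)
    (hA : ∀ x ∈ 𝒟, A' x = A x + Δ x) (hM : ∀ x ∈ 𝒟, M x ∈ 𝒟)
    (hN : ∀ x ∈ 𝒟, A' (M x) - M (A' x) = N x) :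
    IsSylvester 𝒟 A P (N - (Δ * M - M * Δ)) ((1 - P) * M * P) := by
  refine ⟨?_, ?_, fun x => h.one_sub_mem (hM _ (h.mem x)), fun x hx => ?_⟩
  · rw [← mul_assoc, ← mul_assoc, mul_sub, h.idem, mul_one, sub_self, zero_mul, zero_mul]
  · rw [mul_assoc, h.idem]
  · have hMP := hM _ (h.mem x)
    have e := hN _ (h.mem x)
    rw [hA _ hMP, hA _ (h.mem x)] at e
    simp only [mul_apply_eq_comp, h.map_one_sub hMP, h.comm x hx]
    rw [← map_sub]
    congr 1
    rw [sub_apply, ← e]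
    simp only [sub_apply, mul_apply_eq_comp, map_add]
    abel

end IsSylvester

end Sylvester

/-! ### Differentiability of the projection and of Sylvester solutions -/

section Family

variable {E : Type*} [NormedAddCommGroup E] [InnerProductSpace ℂ E]

theorem add_coe_apply_eq (B : ℝ → E →L[ℂ] E) (G : E →ₗ[ℂ] E) (r s : ℝ) (x : E) :
    (G + (B r : E →ₗ[ℂ] E)) x = (G + (B s : E →ₗ[ℂ] E)) x + (B r - B s) x := by
  simp

variable [CompleteSpace E]

/-- The projections `P s` reduce the operators `G + B s`, `s ∈ S`, with a positive gap `δ s`, the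
perturbations `B s` being bounded and differentiable. -/
structure IsReducingFamily (𝒟 : Submodule ℂ E) (G : E →ₗ[ℂ] E) (B B₁ P : ℝ → E →L[ℂ] E)
    (c ρ δ : ℝ → ℝ) (S : Set ℝ) : Prop where
  reducing : ∀ s ∈ S, IsReducing 𝒟 (G + (B s : E →ₗ[ℂ] E)) (P s) (c s) (ρ s) (δ s)
  pos : ∀ s ∈ S, 0 < δ s
  center : ContinuousOn c S
  radius : ContinuousOn ρ S
  gap : ContinuousOn δ S
  deriv : ∀ s ∈ S, HasDerivWithinAt B (B₁ s) S s

variable {𝒟 : Submodule ℂ E} {G : E →ₗ[ℂ] E} {B B₁ P : ℝ → E →L[ℂ] E} {c ρ δ : ℝ → ℝ} {S : Set ℝ}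

namespace IsReducingFamily

theorem exists_norm_proj_sub_le (h : IsReducingFamily 𝒟 G B B₁ P c ρ δ S) {s : ℝ} (hs : s ∈ S) :
    ∃ K, ∀ᶠ r in 𝓝[S] s, ‖P r - P s‖ ≤ K * ‖B r - B s‖ := by
  have hδ := h.pos s hs
  have hc := h.center s hs
  have hρ := h.radius s hs
  have hg := h.gap s hs
  have t1 : Tendsto (fun r => ρ r + δ r - |c r - c s| - ρ s) (𝓝[S] s) (𝓝 (δ s)) := by
    have := (((hρ.tendsto.add hg).sub (hc.tendsto.sub_const (c s)).abs)).sub_const (ρ s)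
    simpa using this
  have t2 : Tendsto (fun r => ρ s + δ s - |c s - c r| - ρ r) (𝓝[S] s) (𝓝 (δ s)) := by
    have := (((tendsto_const_nhds (x := ρ s + δ s)).sub (hc.tendsto.const_sub (c s)).abs)).sub hρ
    simpa using this
  -- Near `s` both Davis–Kahan factors exceed `δ s / 2`, and `P r - P s` consists of two blocks,
  -- each at most `(2 / δ s) ‖B r - B s‖`.
  refine ⟨4 / δ s, ?_⟩
  filter_upwards [t1.eventually (lt_mem_nhds (half_lt_self hδ)),
    t2.eventually (lt_mem_nhds (half_lt_self hδ)), self_mem_nhdsWithin] with r h1 h2 hr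
  have n1 := (h.reducing s hs).norm_one_sub_mul_le (h.reducing r hr)
    fun x _ => add_coe_apply_eq B G r s x
  have n2 := (h.reducing r hr).norm_one_sub_mul_le (h.reducing s hs)
    fun x _ => add_coe_apply_eq B G s r x
  rw [norm_sub_rev (B s)] at n2
  have m1 := mul_le_mul_of_nonneg_right h1.le (norm_nonneg ((1 - P r) * P s))
  have m2 := mul_le_mul_of_nonneg_right h2.le (norm_nonneg ((1 - P s) * P r))
  have e : P r - P s = star ((1 - P s) * P r) - (1 - P r) * P s := by
    rw [star_mul, star_sub, star_one, (h.reducing s hs).star_eq, (h.reducing r hr).star_eq]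
    noncomm_ring
  have := norm_sub_le (star ((1 - P s) * P r)) ((1 - P r) * P s)
  rw [← e, norm_star] at this
  rw [div_mul_eq_mul_div, le_div_iff₀ hδ]
  nlinarith

/-- The spectral projection is differentiable, with derivative given by Sylvester's equation. -/
theorem hasDerivWithinAt_proj (h : IsReducingFamily 𝒟 G B B₁ P c ρ δ S) {s : ℝ} (hs : s ∈ S)
    {T : E →L[ℂ] E} (hT : IsSylvester 𝒟 (G + (B s : E →ₗ[ℂ] E)) (P s) (B₁ s) T) :
    HasDerivWithinAt P (-(T + star T)) S s := by
  have hs' := h.reducing s hs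
  obtain ⟨K, hK⟩ := h.exists_norm_proj_sub_le hs
  have hB := hasDerivWithinAt_iff_tendsto_slope.1 (h.deriv s hs)
  have hle : 𝓝[S \ {s}] s ≤ 𝓝[S] s := nhdsWithin_mono _ Set.sdiff_subset
  have hBc : Tendsto (fun r => ‖B r - B s‖) (𝓝[S] s) (𝓝 0) :=
    tendsto_iff_norm_sub_tendsto_zero.1 (h.deriv s hs).continuousWithinAt.tendsto
  have hP0 : Tendsto (fun r => ‖P r - P s‖) (𝓝[S] s) (𝓝 0) :=
    squeeze_zero' (Eventually.of_forall fun _ => norm_nonneg _) hK (by simpa using hBc.const_mul K)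
  have hPc : Tendsto P (𝓝[S \ {s}] s) (𝓝 (P s)) :=
    (tendsto_iff_norm_sub_tendsto_zero.2 hP0).mono_left hle
  -- By idempotence the diagonal blocks of `P r - P s` are compressions of `±(P r - P s)²`, hence of
  -- second order.
  have hee : Tendsto (fun r => (r - s)⁻¹ • ((P r - P s) * (P r - P s))) (𝓝[S \ {s}] s) (𝓝 0) := by
    refine squeeze_zero_norm' (a := fun r => K * ‖slope B s r‖ * ‖P r - P s‖) ?_ ?_
    · filter_upwards [hle hK] with r hr
      rw [slope_def_module, norm_smul, norm_smul]
      have := mul_le_mul_of_nonneg_right hr (norm_nonneg (P r - P s))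
      have := mul_le_mul_of_nonneg_left ((norm_mul_le (P r - P s) (P r - P s)).trans this)
        (norm_nonneg (r - s)⁻¹)
      linarith
    · simpa using (hB.norm.const_mul K).mul (hP0.mono_left hle)
  -- `P r` commutes with the Hamiltonian at `r`, so its compression solves the equation at `s` with
  -- only the commutator of `B r - B s` and `P r` on the right.
  have hoff : Tendsto (fun r => (r - s)⁻¹ • ((1 - P s) * P r * P s)) (𝓝[S \ {s}] s) (𝓝 (-T)) := by
    have hT' : IsSylvester 𝒟 (G + (B s : E →ₗ[ℂ] E)) (P s) (-(B₁ s * P s - P s * B₁ s)) (-T) := by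
      have := (hT.smul (-1)).congr (Y' := -(B₁ s * P s - P s * B₁ s)) (by
        have e1 : (1 - P s) * P s = 0 := by rw [sub_mul, hs'.idem, one_mul, sub_self]
        have e2 : (1 - P s) * -(B₁ s * P s - P s * B₁ s) * P s
            = -((1 - P s) * B₁ s * (P s * P s)) + (1 - P s) * P s * (B₁ s * P s) := by
          noncomm_ring
        rw [e2, e1, hs'.idem, zero_mul, add_zero]
        simp)
      simpa using this
    refine hT'.tendsto hs' (h.pos s hs)
      (Y' := fun r => (r - s)⁻¹ • (0 - ((B r - B s) * P r - P r * (B r - B s)))) ?_ ?_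
    · filter_upwards [self_mem_nhdsWithin] with r hr
      have hr' := h.reducing r hr.1
      exact (IsSylvester.compress hs' (fun x _ => add_coe_apply_eq B G r s x) (fun x _ => hr'.mem x)
        fun x hx => by rw [hr'.comm x hx, sub_self, zero_apply]).smul _
    · have := ((hB.mul hPc).sub (hPc.mul hB)).neg
      refine this.congr fun r => ?_
      simp only [slope_def_module, zero_sub, smul_neg, smul_mul_assoc, mul_smul_comm, ← smul_sub]
  rw [hasDerivWithinAt_iff_tendsto_slope]
  have hlim := (((hoff.add hoff.star).add ((hee.const_mul (1 - P s)).mul_const (1 - P s))).sub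
    ((hee.const_mul (P s)).mul_const (P s)))
  simp only [mul_zero, zero_mul, add_zero, sub_zero, star_neg, ← neg_add] at hlim
  refine hlim.congr' ?_
  filter_upwards [self_mem_nhdsWithin] with r hr
  have hr' := h.reducing r hr.1
  rw [slope_def_module, star_smul, star_trivial]
  simp only [mul_smul_comm, smul_mul_assoc, ← smul_add, ← smul_sub]
  congr 1
  simp only [star_mul, star_sub, star_one, hs'.star_eq, hr'.star_eq]
  have e1 := hs'.idem
  have e2 := hr'.idem
  have e3 : ∀ a, P s * (P s * a) = P s * a := fun a => by rw [← mul_assoc, e1]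
  simp only [mul_sub, sub_mul, mul_one, one_mul, mul_assoc, e1, e2, e3]
  abel

/-- The solution of Sylvester's equation is differentiable. -/
theorem hasDerivWithinAt_sylvester (h : IsReducingFamily 𝒟 G B B₁ P c ρ δ S) {s : ℝ} (hs : s ∈ S)
    {Y Z : ℝ → E →L[ℂ] E} {P₁ Y₁ W : E →L[ℂ] E} (hP : HasDerivWithinAt P P₁ S s)
    (hY : HasDerivWithinAt Y Y₁ S s)
    (hZ : ∀ r ∈ S, IsSylvester 𝒟 (G + (B r : E →ₗ[ℂ] E)) (P r) (Y r) (Z r))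
    (hW : IsSylvester 𝒟 (G + (B s : E →ₗ[ℂ] E)) (P s)
      ((-P₁ * Y s + (1 - P s) * Y₁) * P s + (1 - P s) * Y s * P₁ - (B₁ s * Z s - Z s * B₁ s)) W) :
    HasDerivWithinAt Z (W - P s * P₁ * Z s + Z s * P₁ * (1 - P s)) S s := by
  have hs' := h.reducing s hs
  have hle : 𝓝[S \ {s}] s ≤ 𝓝[S] s := nhdsWithin_mono _ Set.sdiff_subset
  have hB := hasDerivWithinAt_iff_tendsto_slope.1 (h.deriv s hs)
  have hBc : Tendsto (fun r => B r - B s) (𝓝[S] s) (𝓝 0) := by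
    simpa using (h.deriv s hs).continuousWithinAt.tendsto.sub_const (B s)
  have hPc : Tendsto (fun r => P r - P s) (𝓝[S] s) (𝓝 0) := by
    simpa using hP.continuousWithinAt.tendsto.sub_const (P s)
  have hPs := hasDerivWithinAt_iff_tendsto_slope.1 hP
  let F : ℝ → E →L[ℂ] E := fun r => (1 - P r) * Y r * P r
  have hF : HasDerivWithinAt F
      ((-P₁ * Y s + (1 - P s) * Y₁) * P s + (1 - P s) * Y s * P₁) S s :=
    ((hP.const_sub 1).mul hY).mul hP
  have hFs := hasDerivWithinAt_iff_tendsto_slope.1 hF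
  have hFc : Tendsto (fun r => F r - F s) (𝓝[S] s) (𝓝 0) := by
    simpa using hF.continuousWithinAt.tendsto.sub_const (F s)
  have hsyl : ∀ r ∈ S, IsSylvester 𝒟 (G + (B s : E →ₗ[ℂ] E)) (P s)
      (F r - F s - ((B r - B s) * Z r - Z r * (B r - B s))) ((1 - P s) * Z r * P s - Z s) := by
    intro r hr
    have h1 := IsSylvester.compress hs' (M := Z r) (N := F r)
      (fun x _ => add_coe_apply_eq B G r s x) (fun x _ => (hZ r hr).mem x) (hZ r hr).eq
    have h2 : IsSylvester 𝒟 (G + (B s : E →ₗ[ℂ] E)) (P s) (F s) (Z s) := by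
      refine (hZ s hs).congr ?_
      have e1 := hs'.idem
      have e3 : ∀ a, P s * (P s * a) = P s * a := fun a => by rw [← mul_assoc, e1]
      simp only [F, mul_sub, sub_mul, one_mul, mul_assoc, e1, e3]
      abel
    rw [sub_right_comm]
    exact h1.sub h2
  -- The blocks of `Z r` other than `(1 - P s) Z r P s` are of first order, because `P r * Z r = 0`
  -- and `Z r * P r = Z r`.
  have hdec : ∀ r ∈ S, Z r - Z s = ((1 - P s) * Z r * P s - Z s) - P s * (P r - P s) * Z r
      + (1 - P s) * Z r * (P r - P s) * (1 - P s) := by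
    intro r hr
    have e1 := hs'.idem
    have e2 := (hZ r hr).left
    have e3 := (hZ r hr).right
    simp only [mul_sub, sub_mul, mul_one, one_mul, mul_assoc, e1, e2, e3, mul_zero]
    abel
  have hbound : ∀ᶠ r in 𝓝[S] s, ‖Z r‖ ≤ ‖Y r‖ / δ r := by
    filter_upwards [self_mem_nhdsWithin] with r hr
    exact (hZ r hr).norm_le (h.reducing r hr) (h.pos r hr)
  have hlim0 : Tendsto (fun r => ‖Y r‖ / δ r) (𝓝[S] s) (𝓝 (‖Y s‖ / δ s)) :=
    hY.continuousWithinAt.tendsto.norm.div (h.gap s hs) (h.pos s hs).ne'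
  have small : ∀ D : ℝ → E →L[ℂ] E, Tendsto D (𝓝[S] s) (𝓝 0) →
      Tendsto (fun r => D r * Z r) (𝓝[S] s) (𝓝 0) ∧
      Tendsto (fun r => Z r * D r) (𝓝[S] s) (𝓝 0) := by
    intro D hD
    have h0 : Tendsto (fun r => ‖D r‖ * (‖Y r‖ / δ r)) (𝓝[S] s) (𝓝 0) := by
      simpa using hD.norm.mul hlim0
    constructor
    · refine squeeze_zero_norm' ?_ h0
      filter_upwards [hbound] with r hr
      exact (norm_mul_le _ _).trans (mul_le_mul_of_nonneg_left hr (norm_nonneg _))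
    · refine squeeze_zero_norm' ?_ h0
      filter_upwards [hbound] with r hr
      rw [mul_comm]
      exact (norm_mul_le _ _).trans (mul_le_mul_of_nonneg_right hr (norm_nonneg _))
  -- Local boundedness of `Z` makes the right-hand sides in `hsyl` tend to `0`; comparison with the
  -- zero solution then gives continuity of `Z`, which the difference quotients require.
  have hZero : IsSylvester 𝒟 (G + (B s : E →ₗ[ℂ] E)) (P s) 0 0 := by
    simpa using hW.sub hW
  have hZc : Tendsto Z (𝓝[S] s) (𝓝 (Z s)) := by
    have h1 : Tendsto (fun r => (1 - P s) * Z r * P s - Z s) (𝓝[S] s) (𝓝 0) := by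
      refine hZero.tendsto hs' (h.pos s hs)
        (eventually_of_mem self_mem_nhdsWithin hsyl) ?_
      simpa using hFc.sub ((small _ hBc).1.sub (small _ hBc).2)
    have h2 : Tendsto (fun r => Z r - Z s) (𝓝[S] s) (𝓝 0) := by
      have := (h1.sub ((small _ hPc).1.const_mul (P s))).add
        (((small _ hPc).2.const_mul (1 - P s)).mul_const (1 - P s))
      simp only [mul_zero, zero_mul, sub_zero, add_zero] at this
      refine this.congr' (eventually_of_mem self_mem_nhdsWithin fun r hr => ?_)
      beta_reduce
      rw [hdec r hr]
      simp only [mul_assoc]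
    simpa using h2.add_const (Z s)
  replace hZc := hZc.mono_left hle
  have hoff : Tendsto (fun r => (r - s)⁻¹ • ((1 - P s) * Z r * P s - Z s)) (𝓝[S \ {s}] s)
      (𝓝 W) := by
    refine hW.tendsto hs' (h.pos s hs)
      (eventually_of_mem self_mem_nhdsWithin fun r hr => (hsyl r hr.1).smul _) ?_
    refine (hFs.sub ((hB.mul hZc).sub (hZc.mul hB))).congr fun r => ?_
    simp only [slope_def_module, smul_mul_assoc, mul_smul_comm, ← smul_sub]
  rw [hasDerivWithinAt_iff_tendsto_slope]
  have hlim := (hoff.sub ((hPs.const_mul (P s)).mul hZc)).add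
    (((hZc.const_mul (1 - P s)).mul hPs).mul_const (1 - P s))
  have e : (1 - P s) * Z s = Z s := by rw [sub_mul, (hZ s hs).left, one_mul, sub_zero]
  rw [e] at hlim
  refine hlim.congr' (eventually_of_mem self_mem_nhdsWithin fun r hr => ?_)
  simp only [slope_def_module, mul_smul_comm, smul_mul_assoc, ← smul_add, ← smul_sub]
  rw [hdec r hr.1]

/-- A quantitative form of `hasDerivWithinAt_sylvester`. -/
theorem exists_hasDerivWithinAt_sylvester (h : IsReducingFamily 𝒟 G B B₁ P c ρ δ S) {s : ℝ}
    (hs : s ∈ S) {Y Z : ℝ → E →L[ℂ] E} {P₁ Y₁ : E →L[ℂ] E} (hP : HasDerivWithinAt P P₁ S s)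
    (hY : HasDerivWithinAt Y Y₁ S s)
    (hZ : ∀ r ∈ S, IsSylvester 𝒟 (G + (B r : E →ₗ[ℂ] E)) (P r) (Y r) (Z r)) :
    ∃ Z₁, HasDerivWithinAt Z Z₁ S s ∧ ‖Z₁‖ ≤
      (2 * (‖P₁‖ * ‖Y s‖) + ‖Y₁‖ + 2 * (‖B₁ s‖ * ‖Z s‖)) / δ s + 2 * (‖P₁‖ * ‖Z s‖) := by
  have hs' := h.reducing s hs
  obtain ⟨W, hW⟩ := hs'.solvable
    ((-P₁ * Y s + (1 - P s) * Y₁) * P s + (1 - P s) * Y s * P₁ - (B₁ s * Z s - Z s * B₁ s))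
  refine ⟨_, h.hasDerivWithinAt_sylvester hs hP hY hZ hW, ?_⟩
  have p := hs'.norm_le_one
  have q := hs'.norm_one_sub_le_one
  have left : ∀ {a b : E →L[ℂ] E}, ‖a‖ ≤ 1 → ‖a * b‖ ≤ ‖b‖ := fun {a b} ha =>
    (norm_mul_le a b).trans (mul_le_of_le_one_left (norm_nonneg b) ha)
  have right : ∀ {a b : E →L[ℂ] E}, ‖b‖ ≤ 1 → ‖a * b‖ ≤ ‖a‖ := fun {a b} hb =>
    (norm_mul_le a b).trans (mul_le_of_le_one_right (norm_nonneg a) hb)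
  have hWn := hW.norm_le hs' (h.pos s hs)
  have n1 : ‖-P₁ * Y s + (1 - P s) * Y₁‖ ≤ ‖P₁‖ * ‖Y s‖ + ‖Y₁‖ :=
    (norm_add_le _ _).trans (add_le_add ((norm_mul_le _ _).trans_eq (by rw [norm_neg])) (left q))
  have n2 : ‖(1 - P s) * Y s * P₁‖ ≤ ‖P₁‖ * ‖Y s‖ := by
    rw [mul_assoc, mul_comm ‖P₁‖]
    exact (left q).trans (norm_mul_le _ _)
  have n3 : ‖B₁ s * Z s - Z s * B₁ s‖ ≤ 2 * (‖B₁ s‖ * ‖Z s‖) := by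
    have := norm_sub_le (B₁ s * Z s) (Z s * B₁ s)
    linarith [norm_mul_le (B₁ s) (Z s), norm_mul_le (Z s) (B₁ s)]
  have n4 : ‖(-P₁ * Y s + (1 - P s) * Y₁) * P s + (1 - P s) * Y s * P₁
      - (B₁ s * Z s - Z s * B₁ s)‖ ≤
      2 * (‖P₁‖ * ‖Y s‖) + ‖Y₁‖ + 2 * (‖B₁ s‖ * ‖Z s‖) := by
    refine (norm_sub_le _ _).trans ?_
    have := (norm_add_le ((-P₁ * Y s + (1 - P s) * Y₁) * P s) ((1 - P s) * Y s * P₁))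
    linarith [(right p).trans n1]
  have n5 : ‖P s * P₁ * Z s‖ ≤ ‖P₁‖ * ‖Z s‖ := by
    rw [mul_assoc]; exact (left p).trans (norm_mul_le _ _)
  have n6 : ‖Z s * P₁ * (1 - P s)‖ ≤ ‖P₁‖ * ‖Z s‖ := by
    rw [mul_comm ‖P₁‖]; exact (right q).trans (norm_mul_le _ _)
  have n7 := hWn.trans (div_le_div_of_nonneg_right n4 (h.pos s hs).le)
  refine (norm_add_le _ _).trans ?_
  linarith [norm_sub_le W (P s * P₁ * Z s)]

/-- The derivative of the spectral projection is the commutator of the Hamiltonian with a bounded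
differentiable family `X` that is controlled by the gap. -/
theorem exists_commutator (h : IsReducingFamily 𝒟 G B B₁ P c ρ δ S) {B₂ : ℝ → E →L[ℂ] E}
    (hB₂ : ∀ s ∈ S, HasDerivWithinAt B₁ (B₂ s) S s) :
    ∃ P₁ X X₁ : ℝ → E →L[ℂ] E, ∀ s ∈ S, HasDerivWithinAt P (P₁ s) S s ∧
      HasDerivWithinAt X (X₁ s) S s ∧
      (∀ v ∈ 𝒟, ∀ u ∈ 𝒟, ⟪(G + (B s : E →ₗ[ℂ] E)) v, X s u⟫_ℂ
        - ⟪v, X s ((G + (B s : E →ₗ[ℂ] E)) u)⟫_ℂ = ⟪v, P₁ s u⟫_ℂ) ∧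
      ‖X s‖ ≤ 2 * ‖B₁ s‖ / δ s ^ 2 ∧
      ‖X₁ s‖ ≤ 40 * ‖B₁ s‖ ^ 2 / δ s ^ 3 + 2 * ‖B₂ s‖ / δ s ^ 2 := by
  have hT : ∀ s, ∃ T, s ∈ S → IsSylvester 𝒟 (G + (B s : E →ₗ[ℂ] E)) (P s) (B₁ s) T := fun s => by
    by_cases hs : s ∈ S
    · exact ((h.reducing s hs).solvable (B₁ s)).imp fun _ hT _ => hT
    · exact ⟨0, fun hs' => absurd hs' hs⟩
  choose T hT using hT
  have hZ : ∀ s, ∃ Z, s ∈ S → IsSylvester 𝒟 (G + (B s : E →ₗ[ℂ] E)) (P s) (T s) Z := fun s => by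
    by_cases hs : s ∈ S
    · exact ((h.reducing s hs).solvable (T s)).imp fun _ hZ _ => hZ
    · exact ⟨0, fun hs' => absurd hs' hs⟩
  choose Z hZ using hZ
  have hP : ∀ s ∈ S, HasDerivWithinAt P (-(T s + star (T s))) S s := fun s hs =>
    h.hasDerivWithinAt_proj hs (hT s hs)
  have hT₁ := fun s (hs : s ∈ S) => h.exists_hasDerivWithinAt_sylvester hs (hP s hs) (hB₂ s hs) hT
  -- With `β = ‖B₁ s‖`: `‖T‖ ≤ β/δ`, `‖Z‖ ≤ β/δ²`, `‖P'‖ ≤ 2β/δ`, whence `‖T'‖ ≤ 10β²/δ² + ‖B₂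
  -- s‖/δ`. The quantitative lemma for `Z` then yields `4 + 10 + 2 + 4 = 20`.
  have hZ₁ : ∀ s, ∃ Z₁, s ∈ S → HasDerivWithinAt Z Z₁ S s ∧
      ‖Z₁‖ ≤ 20 * ‖B₁ s‖ ^ 2 / δ s ^ 3 + ‖B₂ s‖ / δ s ^ 2 := by
    intro s
    by_cases hs : s ∈ S
    · obtain ⟨T₁, hTd, hTn⟩ := hT₁ s hs
      obtain ⟨Z₁, hZd, hZn⟩ := h.exists_hasDerivWithinAt_sylvester hs (hP s hs) hTd hZ
      refine ⟨Z₁, fun _ => ⟨hZd, hZn.trans ?_⟩⟩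
      have hδ := h.pos s hs
      have a := (hT s hs).norm_le (h.reducing s hs) hδ
      have b := (hZ s hs).norm_le (h.reducing s hs) hδ
      have b' : ‖Z s‖ ≤ ‖B₁ s‖ / δ s / δ s := b.trans (div_le_div_of_nonneg_right a hδ.le)
      have p : ‖-(T s + star (T s))‖ ≤ 2 * (‖B₁ s‖ / δ s) := by
        rw [norm_neg]
        refine (norm_add_le _ _).trans ?_
        rw [norm_star]; linarith
      have t : ‖T₁‖ ≤ (2 * (2 * (‖B₁ s‖ / δ s) * ‖B₁ s‖) + ‖B₂ s‖
          + 2 * (‖B₁ s‖ * (‖B₁ s‖ / δ s))) / δ s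
          + 2 * (2 * (‖B₁ s‖ / δ s) * (‖B₁ s‖ / δ s)) := by
        refine hTn.trans ?_
        gcongr
      calc _ ≤ (2 * (2 * (‖B₁ s‖ / δ s) * (‖B₁ s‖ / δ s))
            + ((2 * (2 * (‖B₁ s‖ / δ s) * ‖B₁ s‖) + ‖B₂ s‖
              + 2 * (‖B₁ s‖ * (‖B₁ s‖ / δ s))) / δ s
              + 2 * (2 * (‖B₁ s‖ / δ s) * (‖B₁ s‖ / δ s)))
            + 2 * (‖B₁ s‖ * (‖B₁ s‖ / δ s / δ s))) / δ s
            + 2 * (2 * (‖B₁ s‖ / δ s) * (‖B₁ s‖ / δ s / δ s)) := by gcongr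
        _ = _ := by field_simp; ring
    · exact ⟨0, fun hs' => absurd hs' hs⟩
  choose Z₁ hZ₁ using hZ₁
  -- The commutator of the Hamiltonian with `Z` is `T`; taking adjoints, that with `Z*` is `-T*`.
  refine ⟨fun s => -(T s + star (T s)), fun s => star (Z s) - Z s, fun s => star (Z₁ s) - Z₁ s,
    fun s hs => ⟨hP s hs, (hZ₁ s hs).1.star.sub (hZ₁ s hs).1, ?_, ?_, ?_⟩⟩
  · have key : ∀ v ∈ 𝒟, ∀ u ∈ 𝒟, ⟪(G + (B s : E →ₗ[ℂ] E)) v, Z s u⟫_ℂ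
        - ⟪v, Z s ((G + (B s : E →ₗ[ℂ] E)) u)⟫_ℂ = ⟪v, T s u⟫_ℂ := by
      intro v hv u hu
      rw [(h.reducing s hs).symm v hv _ ((hZ s hs).mem u), ← inner_sub_right, (hZ s hs).eq u hu]
      have e : (1 - P s) * T s * P s = T s := by
        rw [mul_assoc, (hT s hs).right, sub_mul, (hT s hs).left, one_mul, sub_zero]
      rw [e]
    have key' : ∀ v ∈ 𝒟, ∀ u ∈ 𝒟, ⟪(G + (B s : E →ₗ[ℂ] E)) v, star (Z s) u⟫_ℂ
        - ⟪v, star (Z s) ((G + (B s : E →ₗ[ℂ] E)) u)⟫_ℂ = -⟪v, star (T s) u⟫_ℂ := by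
      intro v hv u hu
      simp only [ContinuousLinearMap.star_eq_adjoint, ContinuousLinearMap.adjoint_inner_right]
      have := congrArg (starRingEnd ℂ) (key u hu v hv)
      simp only [map_sub, inner_conj_symm] at this
      rw [← this]; ring
    intro v hv u hu
    simp only [sub_apply, neg_apply, add_apply, inner_sub_right, inner_neg_right, inner_add_right]
    rw [← key v hv u hu, ← neg_eq_iff_eq_neg.2 (key' v hv u hu)]
    ring
  · refine (norm_sub_le _ _).trans ?_
    rw [norm_star]
    have hδ := h.pos s hs
    have a := (hT s hs).norm_le (h.reducing s hs) hδ
    have b := (hZ s hs).norm_le (h.reducing s hs) hδ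
    have b' := b.trans (div_le_div_of_nonneg_right a hδ.le)
    rw [div_div, ← sq] at b'
    rw [mul_div_assoc]
    linarith
  · refine (norm_sub_le _ _).trans ?_
    rw [norm_star]
    have := (hZ₁ s hs).2
    rw [mul_div_assoc] at this ⊢
    rw [mul_div_assoc]
    linarith

end IsReducingFamily

end Family

/-! ### The Schrödinger evolution and the transition estimate -/

section Evolution

variable {E : Type*} [NormedAddCommGroup E] [InnerProductSpace ℂ E]

theorem hasDerivWithinAt_apply {L : ℝ → E →L[ℂ] E} {u : ℝ → E} {L₁ : E →L[ℂ] E} {u₁ : E}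
    {S : Set ℝ} {s : ℝ} (hL : HasDerivWithinAt L L₁ S s) (hu : HasDerivWithinAt u u₁ S s) :
    HasDerivWithinAt (fun r => L r (u r)) (L₁ (u s) + L s u₁) S s := by
  have := (ContinuousLinearMap.restrictScalarsL ℂ E E ℝ ℝ).hasFDerivAt.comp_hasDerivWithinAt s hL
  exact HasDerivWithinAt.clm_apply this hu

variable [CompleteSpace E]

/-- A twice differentiable Hamiltonian is a bounded differentiable perturbation of its initial
value. -/
theorem IsTwiceDifferentiable.exists_primitive {𝒟 : Submodule ℂ E} {H : ℝ → 𝒟 →ₗ[ℂ] E}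
    {H₁ H₂ : ℝ → E →L[ℂ] E} (h : IsTwiceDifferentiable H H₁ H₂) :
    ∃ B : ℝ → E →L[ℂ] E, (∀ s ∈ Set.Icc (0 : ℝ) 1, HasDerivWithinAt B (H₁ s) (Set.Icc 0 1) s) ∧
      ∀ s ∈ Set.Icc (0 : ℝ) 1, ∀ x : 𝒟, H s x = H 0 x + B s x := by
  have hc : ContinuousOn H₁ (Set.Icc 0 1) := fun s hs => (h.second s hs).continuousWithinAt
  -- Constant extension beyond `[0,1]` makes the integrand continuous on `ℝ`, so its primitive is
  -- differentiable at the endpoints too.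
  let g : ℝ → E →L[ℂ] E := Set.IccExtend (zero_le_one (α := ℝ)) ((Set.Icc 0 1).domRestrict H₁)
  have hg : Continuous g := hc.domRestrict.Icc_extend'
  have hgs : ∀ s ∈ Set.Icc (0 : ℝ) 1, g s = H₁ s := fun s hs => by
    simp [g, Set.IccExtend_of_mem _ _ hs, Set.domRestrict]
  let B : ℝ → E →L[ℂ] E := fun s => ∫ r in (0 : ℝ)..s, g r
  have hB : ∀ s ∈ Set.Icc (0 : ℝ) 1, HasDerivWithinAt B (H₁ s) (Set.Icc 0 1) s := fun s hs => by
    rw [← hgs s hs]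
    exact (hg.integral_hasStrictDerivAt 0 s).hasDerivAt.hasDerivWithinAt
  refine ⟨B, hB, fun s hs x => ?_⟩
  have hd : ∀ r ∈ Set.Icc (0 : ℝ) 1,
      HasDerivWithinAt (fun r => H r x - B r (x : E)) 0 (Set.Icc 0 1) r := fun r hr => by
    have := (h.first r hr x).sub
      (hasDerivWithinAt_apply (hB r hr) (hasDerivWithinAt_const r (Set.Icc 0 1) (x : E)))
    simp only [map_zero, add_zero, sub_self] at this
    exact this
  have := (convex_Icc (0 : ℝ) 1).norm_image_sub_le_of_norm_hasDerivWithin_le hd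
    (C := 0) (fun _ _ => by simp) (Set.left_mem_Icc.2 zero_le_one) hs
  have hB0 : B 0 = 0 := intervalIntegral.integral_same
  rw [zero_mul, norm_le_zero_iff, hB0, zero_apply, sub_zero, sub_eq_zero] at this
  rw [← this]; abel

theorem IsHamiltonian.isDiagonal {𝒟 : Submodule ℂ E} {H : 𝒟 →ₗ[ℂ] E} {A : E →ₗ[ℂ] E} {J : Set ℕ}
    {lam : ℕ → ℝ} {φ : ℕ → E} (hH : IsHamiltonian H) (hφ : IsEigenbasis H J lam φ)
    (hA : ∀ x : 𝒟, A x = H x) : IsDiagonal 𝒟 A J lam φ := by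
  have hdense : Dense ((LinearPMap.mk 𝒟 H).domain : Set E) := IsSelfAdjoint.dense_domain hH
  have hadj : (LinearPMap.mk 𝒟 H).adjoint = LinearPMap.mk 𝒟 H := LinearPMap.isSelfAdjoint_def.1 hH
  refine ⟨hφ.orthonormal, hφ.total, hφ.monotone, fun j hj => (hφ.eigen j hj).1, fun j hj => ?_,
    fun x hx y hy => ?_, fun y w hw => ?_⟩
  · obtain ⟨hm, he⟩ := hφ.eigen j hj
    rw [← he, ← hA]
  · have := LinearPMap.adjoint_isFormalAdjoint hdense
    rw [hadj] at this
    have := this ⟨x, hx⟩ ⟨y, hy⟩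
    rw [hA ⟨x, hx⟩, hA ⟨y, hy⟩]
    exact this
  · have : y ∈ (LinearPMap.mk 𝒟 H).adjoint.domain :=
      LinearPMap.mem_adjoint_domain_of_exists y ⟨w, fun x => (hw x x.2).trans (by rw [hA x]; rfl)⟩
    rwa [hadj] at this

variable {𝒟 : Submodule ℂ E} {A : ℝ → E →ₗ[ℂ] E} {P P₁ X X₁ U : ℝ → E →L[ℂ] E} {τ : ℝ}

/-- The derivative of `⟨v, (1 - P) u⟩ - (i / τ) ⟨v, X u⟩` along two solutions `u`, `v` of the
Schrödinger equation. -/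
theorem hasDerivWithinAt_corrected {S : Set ℝ} {s : ℝ} {P X : ℝ → E →L[ℂ] E}
    {A : E →ₗ[ℂ] E} {P₁ X₁ : E →L[ℂ] E} {u v : ℝ → E} {c ρ δ : ℝ} (hτ : τ ≠ 0)
    (hred : IsReducing 𝒟 A (P s) c ρ δ) (hP : HasDerivWithinAt P P₁ S s)
    (hX : HasDerivWithinAt X X₁ S s) (hu : HasDerivWithinAt u (-(Complex.I * τ) • A (u s)) S s)
    (hv : HasDerivWithinAt v (-(Complex.I * τ) • A (v s)) S s) (hus : u s ∈ 𝒟) (hvs : v s ∈ 𝒟)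
    (hcomm : ⟪A (v s), X s (u s)⟫_ℂ - ⟪v s, X s (A (u s))⟫_ℂ = ⟪v s, P₁ (u s)⟫_ℂ) :
    HasDerivWithinAt (fun r => ⟪v r, (1 - P r) (u r)⟫_ℂ - Complex.I / τ * ⟪v r, X r (u r)⟫_ℂ)
      (-(Complex.I / τ * ⟪v s, X₁ (u s)⟫_ℂ)) S s := by
  have h1 := hv.inner ℂ (hasDerivWithinAt_apply (hP.const_sub 1) hu)
  have h2 := (hv.inner ℂ (hasDerivWithinAt_apply hX hu)).const_mul (Complex.I / τ)
  refine (h1.sub h2).congr_deriv ?_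
  have e : ⟪A (v s), (1 - P s) (u s)⟫_ℂ = ⟪v s, (1 - P s) (A (u s))⟫_ℂ := by
    rw [hred.symm _ hvs _ (hred.one_sub_mem hus), hred.map_one_sub hus]
  have hτ' : (τ : ℂ) ≠ 0 := Complex.ofReal_ne_zero.2 hτ
  simp only [inner_add_right, inner_smul_left, inner_smul_right, neg_apply, inner_neg_right,
    map_smul, e, map_neg, map_mul, Complex.conj_I, Complex.conj_ofReal]
  rw [← hcomm]
  field_simp
  ring_nf
  simp only [Complex.I_sq]
  ring

/-- Only the majorant `φ` has to be integrable; nothing is asked of `X₁` beyond the pointwise bound.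
-/
theorem IsReducing.norm_inner_transition_le {A : ℝ → E →ₗ[ℂ] E} {c ρ δ φ : ℝ → ℝ} (hτ : 0 < τ)
    (hred : ∀ s ∈ Set.Icc (0 : ℝ) 1, IsReducing 𝒟 (A s) (P s) (c s) (ρ s) (δ s))
    (hP : ∀ s ∈ Set.Icc (0 : ℝ) 1, HasDerivWithinAt P (P₁ s) (Set.Icc 0 1) s)
    (hX : ∀ s ∈ Set.Icc (0 : ℝ) 1, HasDerivWithinAt X (X₁ s) (Set.Icc 0 1) s)
    (hcomm : ∀ s ∈ Set.Icc (0 : ℝ) 1, ∀ v ∈ 𝒟, ∀ u ∈ 𝒟,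
      ⟪A s v, X s u⟫_ℂ - ⟪v, X s (A s u)⟫_ℂ = ⟪v, P₁ s u⟫_ℂ)
    (hU : ∀ s ∈ Set.Icc (0 : ℝ) 1, U s ∈ unitary (E →L[ℂ] E)) (hU0 : U 0 = 1)
    (hmem : ∀ s ∈ Set.Icc (0 : ℝ) 1, ∀ x ∈ 𝒟, U s x ∈ 𝒟)
    (hS : ∀ s ∈ Set.Icc (0 : ℝ) 1, ∀ x ∈ 𝒟,
      HasDerivWithinAt (fun r => U r x) (-(Complex.I * τ) • A s (U s x)) (Set.Icc 0 1) s)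
    {s : ℝ} (hs : s ∈ Set.Icc (0 : ℝ) 1)
    (hφ : ∀ r ∈ Set.Icc (0 : ℝ) 1, ‖X₁ r‖ / τ ≤ φ r)
    (hint : IntervalIntegrable φ MeasureTheory.volume 0 s) {x y : E} (hx : x ∈ 𝒟) (hy : y ∈ 𝒟)
    (hPx : P 0 x = x) :
    ‖⟪U s y, (1 - P s) (U s x)⟫_ℂ‖ ≤
      (‖X 0‖ / τ + ‖X s‖ / τ + ∫ r in (0 : ℝ)..s, φ r) * (‖x‖ * ‖y‖) := by
  set f : ℝ → ℂ := fun r =>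
    ⟪U r y, (1 - P r) (U r x)⟫_ℂ - Complex.I / τ * ⟪U r y, X r (U r x)⟫_ℂ with hf
  have hnU : ∀ r ∈ Set.Icc (0 : ℝ) 1, ∀ z, ‖U r z‖ = ‖z‖ := fun r hr z =>
    ContinuousLinearMap.norm_map_of_mem_unitary (hU r hr) z
  have hfd : ∀ r ∈ Set.Icc (0 : ℝ) 1,
      HasDerivWithinAt f (-(Complex.I / τ * ⟪U r y, X₁ r (U r x)⟫_ℂ)) (Set.Icc 0 1) r :=
    fun r hr => hasDerivWithinAt_corrected hτ.ne' (hred r hr) (hP r hr) (hX r hr) (hS r hr x hx)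
      (hS r hr y hy) (hmem r hr x hx) (hmem r hr y hy)
      (hcomm r hr _ (hmem r hr y hy) _ (hmem r hr x hx))
  have hterm : ∀ r ∈ Set.Icc (0 : ℝ) 1, ∀ L : E →L[ℂ] E,
      ‖Complex.I / τ * ⟪U r y, L (U r x)⟫_ℂ‖ ≤ ‖L‖ / τ * (‖x‖ * ‖y‖) := by
    intro r hr L
    rw [norm_mul, norm_div, Complex.norm_I, Complex.norm_real, Real.norm_eq_abs, abs_of_pos hτ]
    have h1 := (norm_inner_le_norm (𝕜 := ℂ) (U r y) (L (U r x))).trans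
      (mul_le_mul_of_nonneg_left (L.le_opNorm _) (norm_nonneg _))
    rw [hnU r hr, hnU r hr] at h1
    calc _ ≤ 1 / τ * (‖y‖ * (‖L‖ * ‖x‖)) := by gcongr
      _ = _ := by ring
  have hd : ∀ r ∈ Set.Ioo 0 s, HasDerivAt f (-(Complex.I / τ * ⟪U r y, X₁ r (U r x)⟫_ℂ)) r :=
    fun r hr => (hfd r ⟨hr.1.le, hr.2.le.trans hs.2⟩).hasDerivAt
      (Icc_mem_nhds hr.1 (hr.2.trans_le hs.2))
  have hI := norm_sub_le_integral_of_norm_deriv_le_of_le (f := f)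
    (B := fun r => φ r * (‖x‖ * ‖y‖)) hs.1
    (fun r hr => (hfd r ⟨hr.1, hr.2.trans hs.2⟩).continuousWithinAt.mono
      (Set.Icc_subset_Icc_right hs.2))
    (fun r hr => (hd r hr).differentiableAt.differentiableWithinAt)
    (Eventually.of_forall fun r hr => by
      have hr' : r ∈ Set.Icc (0 : ℝ) 1 := ⟨hr.1.le, hr.2.le.trans hs.2⟩
      rw [(hd r hr).deriv, norm_neg]
      exact (hterm r hr' _).trans (mul_le_mul_of_nonneg_right (hφ r hr') (by positivity)))
    (hint.mul_const _)
  rw [intervalIntegral.integral_mul_const] at hI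
  have h0 : (0 : ℝ) ∈ Set.Icc (0 : ℝ) 1 := Set.left_mem_Icc.2 zero_le_one
  have hf0 : f 0 = -(Complex.I / τ * ⟪U 0 y, X 0 (U 0 x)⟫_ℂ) := by
    simp [hf, hU0, hPx]
  have e : ⟪U s y, (1 - P s) (U s x)⟫_ℂ
      = (f s - f 0) + f 0 + Complex.I / τ * ⟪U s y, X s (U s x)⟫_ℂ := by
    simp only [hf]; ring
  rw [e]
  refine norm_add₃_le.trans ?_
  have b0 : ‖f 0‖ ≤ ‖X 0‖ / τ * (‖x‖ * ‖y‖) := by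
    rw [hf0, norm_neg]; exact hterm 0 h0 _
  linarith [hterm s hs (X s)]

end Evolution

theorem one_le_ratio {lam : ℕ → ℝ} {m n : ℕ} (hle : lam m ≤ lam n) (hgap : 0 < gap lam m n) :
    1 ≤ ratio lam m n := by
  have : 0 ≤ width lam m n := sub_nonneg.2 hle
  rw [ratio]
  have : 0 ≤ 2 * width lam m n / (Real.pi * gap lam m n) := by positivity
  linarith

/-- At `D = 1` the density already has coefficients `8 · 8 · 2 = 128 ≥ 40` and `8 ≥ 2`, and it
increases with `D`. -/
theorem le_errorDensity {τ D γ b₁ b₂ β₁ β₂ : ℝ} (hτ : 0 < τ) (hD : 1 ≤ D) (hγ : 0 < γ)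
    (hβ₁ : 0 ≤ β₁) (hβ₂ : 0 ≤ β₂) (h₁ : β₁ ≤ b₁) (h₂ : β₂ ≤ b₂) :
    (40 * β₁ ^ 2 / γ ^ 3 + 2 * β₂ / γ ^ 2) / τ ≤ errorDensity τ D γ b₁ b₂ := by
  have hb₁ : 0 ≤ b₁ := hβ₁.trans h₁
  have hb₂ : 0 ≤ b₂ := hβ₂.trans h₂
  rw [errorDensity]
  calc (40 * β₁ ^ 2 / γ ^ 3 + 2 * β₂ / γ ^ 2) / τ
      ≤ (128 * b₁ ^ 2 / γ ^ 3 + 8 * b₂ / γ ^ 2) / τ := by gcongr <;> norm_num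
    _ = 8 * 1 ^ 2 / (τ * γ ^ 2) * (8 * (1 + 1) * b₁ ^ 2 / γ + b₂) := by field_simp; ring
    _ ≤ _ := by gcongr

theorem le_boundaryTerm {τ D γ b₁ β₁ : ℝ} (hτ : 0 < τ) (hD : 1 ≤ D) (hγ : 0 < γ)
    (hβ₁ : 0 ≤ β₁) (h₁ : β₁ ≤ b₁) :
    2 * β₁ / γ ^ 2 / τ ≤ 8 * D ^ 2 * b₁ / (τ * γ ^ 2) := by
  have hb₁ : 0 ≤ b₁ := hβ₁.trans h₁
  calc 2 * β₁ / γ ^ 2 / τ ≤ 8 * b₁ / γ ^ 2 / τ := by gcongr; norm_num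
    _ = 8 * 1 ^ 2 * b₁ / (τ * γ ^ 2) := by field_simp
    _ ≤ _ := by gcongr

/-! ### Continuity of the eigenvalues and the band family -/

section Spectrum

variable {E : Type*} [NormedAddCommGroup E] [InnerProductSpace ℂ E] [CompleteSpace E]

/-- A band of eigenvalues that is separated by a gap gives a reducing family of projections. -/
theorem isReducingFamily_bandProj {𝒟 : Submodule ℂ E} {G : E →ₗ[ℂ] E} {B B₁ : ℝ → E →L[ℂ] E}
    {J : Set ℕ} {lam : ℝ → ℕ → ℝ} {ψ : ℝ → ℕ → E} {m n : ℕ} {S : Set ℝ} (hJ : IsLowerSet J)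
    (hmn : m ≤ n) (hn : n + 1 ∈ J) (hB : ∀ s ∈ S, HasDerivWithinAt B (B₁ s) S s)
    (hdiag : ∀ s ∈ S, IsDiagonal 𝒟 (G + (B s : E →ₗ[ℂ] E)) J (lam s) (ψ s))
    (hgap : ∀ s ∈ S, 0 < gap (lam s) m n) :
    IsReducingFamily 𝒟 G B B₁ (fun s => bandProj (ψ s) m n)
      (fun s => (lam s m + lam s n) / 2) (fun s => width (lam s) m n / 2)
      (fun s => gap (lam s) m n) S := by
  have hlam : ∀ j ∈ J, ContinuousOn (fun s => lam s j) S := by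
    intro j hj s hs
    refine tendsto_iff_norm_sub_tendsto_zero.2 (squeeze_zero' (Eventually.of_forall fun _ =>
      norm_nonneg _) ?_ (tendsto_iff_norm_sub_tendsto_zero.1 (hB s hs).continuousWithinAt.tendsto))
    filter_upwards [self_mem_nhdsWithin] with r hr
    exact (hdiag s hs).abs_eigenvalue_sub_le (hdiag r hr)
      (fun x _ => add_coe_apply_eq B G r s x) hJ hj
  have hI : ∀ i ≤ n + 1, i ∈ J := fun i hi => hJ hi hn
  have cm := hlam m (hI m (by omega))
  have cn := hlam n (hI n (by omega))
  refine ⟨fun s hs => (hdiag s hs).isReducing hJ hn hmn (hgap s hs), hgap,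
    (cm.add cn).div_const 2, (cn.sub cm).div_const 2, ?_, hB⟩
  have c1 := (hlam (n + 1) hn).sub cn
  unfold gap
  split_ifs with h0
  · exact c1
  · exact ContinuousOn.inf c1 (cm.sub (hlam (m - 1) (hI _ (by omega))))

end Spectrum

end Adiabatic

/-! ### The adiabatic theorem -/

theorem mainTheorem1
    {E : Type*} [NormedAddCommGroup E] [InnerProductSpace ℂ E] [CompleteSpace E]
    -- the Hamiltonian evolution, its derivatives and their bounds
    (𝒟 : Submodule ℂ E) (H : ℝ → 𝒟 →ₗ[ℂ] E) (H₁ H₂ : ℝ → E →L[ℂ] E) (b₁ b₂ : ℝ → ℝ)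
    (hH : ∀ s ∈ Set.Icc (0 : ℝ) 1, Adiabatic.IsHamiltonian (H s))
    (hdiff : Adiabatic.IsTwiceDifferentiable H H₁ H₂)
    (hb₁ : ∀ s ∈ Set.Icc (0 : ℝ) 1, ‖H₁ s‖ ≤ b₁ s)
    (hb₂ : ∀ s ∈ Set.Icc (0 : ℝ) 1, ‖H₂ s‖ ≤ b₂ s)
    -- countably many eigenstates `ψ s j` and ordered eigenvalues `lam s j`
    (J : Set ℕ) (hJ : IsLowerSet J) (lam : ℝ → ℕ → ℝ) (ψ : ℝ → ℕ → E)
    (hψ : ∀ s ∈ Set.Icc (0 : ℝ) 1, Adiabatic.IsEigenbasis (H s) J (lam s) (ψ s))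
    -- the band `lam s m, …, lam s n` and its gap
    (m n : ℕ) (hmn : m ≤ n) (hn : n + 1 ∈ J)
    (hgap : ∀ s ∈ Set.Icc (0 : ℝ) 1, 0 < Adiabatic.gap (lam s) m n)
    -- the unitary evolution
    (τ : ℝ) (hτ : 0 < τ) (U : ℝ → E →L[ℂ] E) (hU : Adiabatic.IsEvolution H τ U)
    (s : ℝ) (hs : s ∈ Set.Icc (0 : ℝ) 1)
    -- the integral in the bound exists
    (hint : IntervalIntegrable (fun r => Adiabatic.errorDensity τ (Adiabatic.ratio (lam r) m n)
      (Adiabatic.gap (lam r) m n) (b₁ r) (b₂ r)) MeasureTheory.volume 0 s) :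
    ‖(1 - Adiabatic.bandProj (ψ s) m n) * U s * Adiabatic.bandProj (ψ 0) m n‖ ≤
      8 * Adiabatic.ratio (lam 0) m n ^ 2 * b₁ 0 / (τ * Adiabatic.gap (lam 0) m n ^ 2)
      + 8 * Adiabatic.ratio (lam s) m n ^ 2 * b₁ s / (τ * Adiabatic.gap (lam s) m n ^ 2)
      + ∫ r in (0 : ℝ)..s, Adiabatic.errorDensity τ (Adiabatic.ratio (lam r) m n)
          (Adiabatic.gap (lam r) m n) (b₁ r) (b₂ r) := by

  have h0 : (0 : ℝ) ∈ Set.Icc (0 : ℝ) 1 := Set.left_mem_Icc.2 zero_le_one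
  obtain ⟨B, hB, hHB⟩ := hdiff.exists_primitive
  -- An arbitrary algebraic extension of `H 0` to all of `E`; its values off `𝒟` carry no
  -- information and only spare the coercions.
  obtain ⟨G, hG⟩ := LinearMap.exists_extend (H 0)
  have hA : ∀ s ∈ Set.Icc (0 : ℝ) 1, ∀ x : 𝒟, (G + (B s : E →ₗ[ℂ] E)) x = H s x :=
    fun s hs x => by
      rw [hHB s hs x, ← hG]; rfl
  have hdiag := fun s hs => (hH s hs).isDiagonal (hψ s hs) (hA s hs)
  have hfam := Adiabatic.isReducingFamily_bandProj hJ hmn hn hB hdiag hgap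
  obtain ⟨P₁, X, X₁, hX⟩ := hfam.exists_commutator hdiff.second
  have hmem : ∀ r ∈ Set.Icc (0 : ℝ) 1, ∀ x ∈ 𝒟, U r x ∈ 𝒟 := fun r hr x hx =>
    (hU.schrodinger r hr ⟨x, hx⟩).1
  have hS : ∀ r ∈ Set.Icc (0 : ℝ) 1, ∀ x ∈ 𝒟, HasDerivWithinAt (fun r => U r x)
      (-(Complex.I * τ) • (G + (B r : E →ₗ[ℂ] E)) (U r x)) (Set.Icc 0 1) r := fun r hr x hx => by
    obtain ⟨hm, hd⟩ := hU.schrodinger r hr ⟨x, hx⟩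
    rwa [← hA r hr] at hd
  have hD : ∀ r ∈ Set.Icc (0 : ℝ) 1, 1 ≤ Adiabatic.ratio (lam r) m n := fun r hr =>
    Adiabatic.one_le_ratio ((hdiag r hr).mem_Icc_of_band hJ hn
      (⟨hmn, le_rfl⟩ : n ∈ Set.Icc m n)).1 (hgap r hr)
  have hφ : ∀ r ∈ Set.Icc (0 : ℝ) 1, ‖X₁ r‖ / τ ≤ Adiabatic.errorDensity τ
      (Adiabatic.ratio (lam r) m n) (Adiabatic.gap (lam r) m n) (b₁ r) (b₂ r) := fun r hr =>
    (div_le_div_of_nonneg_right (hX r hr).2.2.2.2 hτ.le).trans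
      (Adiabatic.le_errorDensity hτ (hD r hr) (hgap r hr) (norm_nonneg _) (norm_nonneg _)
        (hb₁ r hr) (hb₂ r hr))
  have hXn : ∀ r ∈ Set.Icc (0 : ℝ) 1, ‖X r‖ / τ ≤ 8 * Adiabatic.ratio (lam r) m n ^ 2 * b₁ r
      / (τ * Adiabatic.gap (lam r) m n ^ 2) := fun r hr =>
    (div_le_div_of_nonneg_right (hX r hr).2.2.2.1 hτ.le).trans
      (Adiabatic.le_boundaryTerm hτ (hD r hr) (hgap r hr) (norm_nonneg _) (hb₁ r hr))
  set C := 8 * Adiabatic.ratio (lam 0) m n ^ 2 * b₁ 0 / (τ * Adiabatic.gap (lam 0) m n ^ 2)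
      + 8 * Adiabatic.ratio (lam s) m n ^ 2 * b₁ s / (τ * Adiabatic.gap (lam s) m n ^ 2)
      + ∫ r in (0 : ℝ)..s, Adiabatic.errorDensity τ (Adiabatic.ratio (lam r) m n)
          (Adiabatic.gap (lam r) m n) (b₁ r) (b₂ r) with hC
  have hle : ‖X 0‖ / τ + ‖X s‖ / τ + ∫ r in (0 : ℝ)..s, Adiabatic.errorDensity τ
      (Adiabatic.ratio (lam r) m n) (Adiabatic.gap (lam r) m n) (b₁ r) (b₂ r) ≤ C := by
    linarith [hXn 0 h0, hXn s hs]
  have hI : 0 ≤ ∫ r in (0 : ℝ)..s, Adiabatic.errorDensity τ (Adiabatic.ratio (lam r) m n)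
      (Adiabatic.gap (lam r) m n) (b₁ r) (b₂ r) :=
    intervalIntegral.integral_nonneg hs.1 fun r hr =>
      (div_nonneg (norm_nonneg _) hτ.le).trans (hφ r ⟨hr.1, hr.2.trans hs.2⟩)
  have hC0 : 0 ≤ C := le_trans (by positivity) hle
  refine ContinuousLinearMap.opNorm_le_bound _ hC0 fun x => ?_
  have hred := hfam.reducing 0 h0
  set x₀ := Adiabatic.bandProj (ψ 0) m n x
  have hx₀ : ‖x₀‖ ≤ ‖x‖ :=
    (ContinuousLinearMap.le_of_opNorm_le _ hred.norm_le_one x).trans_eq (one_mul _)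
  set z : E := (1 - Adiabatic.bandProj (ψ s) m n) (U s x₀)
  have hdense : Dense (𝒟 : Set E) := (hH 0 h0).dense_domain
  -- The Schrödinger equation is available only for `y` in `𝒟`, and density extends the bound to all
  -- `y`. The vector `x₀` lies in `𝒟` already, being in the range of `P(0)`.
  have key : ∀ y, ‖inner ℂ (U s y) z‖ ≤ C * ‖x‖ * ‖y‖ := by
    refine isClosed_property hdense.denseRange_val
      (isClosed_le (by fun_prop) (by fun_prop)) fun y => ?_
    have := Adiabatic.IsReducing.norm_inner_transition_le hτ hfam.reducing (fun r hr => (hX r hr).1)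
      (fun r hr => (hX r hr).2.1) (fun r hr => (hX r hr).2.2.1) hU.unitary hU.initial hmem hS hs
      hφ hint (hred.mem x) y.2 (hred.proj_proj x)
    refine this.trans ?_
    rw [mul_assoc]
    exact mul_le_mul hle (mul_le_mul_of_nonneg_right hx₀ (norm_nonneg _)) (by positivity) hC0
  have hz : U s (star (U s) z) = z := DFunLike.congr_fun (Unitary.mul_star_self_of_mem
    (hU.unitary s hs)) z
  have hzn : ‖star (U s) z‖ = ‖z‖ := by
    rw [← ContinuousLinearMap.norm_map_of_mem_unitary (hU.unitary s hs), hz]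
  -- With this `y` one has `U s y = z`, so the bound reads `‖z‖² ≤ C ‖x‖ ‖z‖`.
  have := key (star (U s) z)
  rw [hz, hzn, inner_self_eq_norm_sq_to_K, norm_pow, RCLike.norm_ofReal, abs_norm, sq] at this
  change ‖z‖ ≤ C * ‖x‖
  rcases (norm_nonneg z).eq_or_lt with h | h
  · rw [← h]; positivity
  · exact le_of_mul_le_mul_right this h
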